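/- **Conventions.** All states are density matrices on finitely many qubits; circuits are generalized quantum circuits over the gate set $\{H,T,\mathrm{CNOT}\}$ (some wires start in $|0\rangle$, some wires are traced out at the end), and the size of a circuit is its number of gates and wires. $F(\rho,\sigma)=\big(\operatorname{Tr}\sqrt{\sqrt\rho\,\sigma\sqrt\rho}\big)^2$ is the fidelity, $\mathrm{TD}(\rho,\sigma)=\frac12\|\rho-\sigma\|_1$ the trace distance, and $\Phi$ an EPR pair shared by $A$ and $B$. A function $\mathbb N\to\mathbb N$ is polynomially bounded if it is at most some polynomial everywhere; $\mu:\mathbb N\to\mathbb R$ is negligible if for every positive polynomial $P$, $|\mu(\lambda)|<1/P(\lambda)$ for all large $\lambda$. *Computational indistinguishability.* Families $\{\rho_\lambda\}$, $\{\sigma_\lambda\}$ are computationally indistinguishable if for every non-uniform family $\mathcal D$ of polynomial-size circuits, taking the state and an advice register to one output bit, there is a negligible $\mu$ with $|\Pr[1\leftarrow\mathcal D^{\alpha}(\rho_\lambda)]-\Pr[1\leftarrow\mathcal D^{\alpha}(\sigma_\lambda)]|\le\mu(\lambda)$ for all $\lambda$ and all quantum advice states $\alpha$. *EFI pair.* Families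 $\rho_{0,\lambda},\rho_{1,\lambda}$ of $m(\lambda)$-qubit states form an EFI pair if (i) some uniform quantum polynomial-time algorithm (polynomial-size circuits with descriptions computable by a Turing machine from $1^\lambda$ in polynomial time) outputs $\rho_{b,\lambda}$ on input $(1^\lambda,b)$, $b\in\{0,1\}$; (ii) $\mathrm{TD}(\rho_{0,\lambda},\rho_{1,\lambda})\ge 1/P(\lambda)$ for all $\lambda$, for some polynomial $P$ that is positive on $\mathbb N$; (iii) the two families are computationally indistinguishable. *Entanglement.* For $\varepsilon\in[0,1]$ and a bipartite state $\rho_{AB}$, $E_D^\varepsilon(\rho_{AB})$ is the supremum of all $k\in\mathbb N$ for which some LOCC map $\Gamma$ (finitely many rounds) has $F(\Gamma(\rho_{AB}),\Phi^{\otimes k})\ge1-\varepsilon$, and $E_C^\varepsilon(\rho_{AB})$ is the infimum of all $k\in\mathbb N$ for which some LOCC map $\Gamma$ has $F(\Gamma(\Phi^{\otimes k}),\rho_{AB})\ge1-\varepsilon$. For a family of bipartite states and $\varepsilon:\mathbb N\to[0,1]$, $\hat E_C^\varepsilon(\{\rho^\lambda_{AB}\}_\lambda)=0$ means that there are LOCC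 maps $\hat\Gamma^\lambda$, made of generalized circuits with classical communication and of total description size polynomial in $\lambda$, that use no EPR pairs and prepare a state with fidelity at least $1-\varepsilon(\lambda)$ with $\rho^\lambda_{AB}$, for all $\lambda$. **Corollary.** Let $\rho_{0,\lambda},\rho_{1,\lambda}$ be an EFI pair of $m(\lambda)$-qubit states. There is a polynomially bounded $n:\mathbb N\to\mathbb N$, of the form $n(\lambda)=t(\lambda)m(\lambda)+1$ with $t$ polynomially bounded, such that for every polynomially bounded $q:\mathbb N\to\mathbb N$ (in particular for every polynomial) there are a function $\varepsilon:\mathbb N\to[0,1]$ with $\varepsilon\in O(2^{-\lambda})$ and two families $\{\psi_{AB}^\lambda\}_\lambda$, $\{\phi_{AB}^\lambda\}_\lambda$ of bipartite states on $q(\lambda)n(\lambda)+q(\lambda)$ qubits, $q(\lambda)n(\lambda)$ of them held by $A$ and $q(\lambda)$ by $B$, such that: 1. $\hat E_C^\varepsilon(\{\psi_{AB}^\lambda\}_\lambda)=0$, and $E^{\varepsilon(\lambda)}(\psi_{AB}^\lambda)=0$ for all $\lambda$ and every $[0,\infty]$-valued function $E^\delta$ of bipartite states with $E^\delta\le E_C^\delta$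 for all $\delta\in[0,1]$; 2. $E_D^{\varepsilon(\lambda)}(\phi_{AB}^\lambda)\ge q(\lambda)$ for all $\lambda$, and $E^{\varepsilon(\lambda)}(\phi_{AB}^\lambda)\ge q(\lambda)$ for all $\lambda$ and every $[0,\infty]$-valued function $E^\delta$ of bipartite states with $E^\delta\ge E_D^\delta$ for all $\delta\in[0,1]$; 3. for every polynomially bounded $p:\mathbb N\to\mathbb N$, the families $\{(\psi_{AB}^\lambda)^{\otimes p(\lambda)}\}_\lambda$ and $\{(\phi_{AB}^\lambda)^{\otimes p(\lambda)}\}_\lambda$ are computationally indistinguishable. -/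

import Mathlib

open scoped ComplexOrder MatrixOrder Kronecker ENNReal

noncomputable section

namespace PseudoEnt

/-! ### Growth conditions -/

/-- `f` is bounded by a polynomial. -/
def PolyBounded (f : ℕ → ℕ) : Prop :=
  ∃ P : Polynomial ℕ, ∀ l, f l ≤ P.eval l

/-- `μ` is negligible: eventually smaller in absolute value than `1 / P` for every positive
polynomial `P`. -/
def Negligible (μ : ℕ → ℝ) : Prop :=
  ∀ P : Polynomial ℝ, (∀ l : ℕ, 0 < P.eval (l : ℝ)) →
    ∃ N : ℕ, ∀ l : ℕ, N < l → |μ l| < 1 / P.eval (l : ℝ)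

/-! ### Quantum states

A register of qubits is given by a finite type `ι` of qubit labels; its computational basis is
`Bits ι`, and operators on it are complex matrices indexed by `Bits ι`. -/

/-- Assignments of a bit to every label: the computational basis of the qubit register `ι`. -/
abbrev Bits (ι : Type) : Type := ι → Bool

/-- Density matrices on the space with orthonormal basis `X`. -/
structure DensityMatrix (X : Type) [Fintype X] where
  mat : Matrix X X ℂ
  posSemidef : mat.PosSemidef
  trace_eq_one : mat.trace = 1

/-- Bipartite states: party `A` holds `a` qubits and party `B` holds `b` qubits. -/
abbrev BipartiteState (a b : ℕ) : Type := DensityMatrix (Bits (Fin a) × Bits (Fin b))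

/-- The trace distance `½ Tr √((ρ - σ)† (ρ - σ))`. -/
def traceDistance {X : Type} [Fintype X] [DecidableEq X] (ρ σ : Matrix X X ℂ) : ℝ :=
  (1 / 2) * (CFC.sqrt ((ρ - σ).conjTranspose * (ρ - σ))).trace.re

/-- The fidelity `(Tr √(√ρ σ √ρ))²`. -/
def fidelity {X : Type} [Fintype X] [DecidableEq X] (ρ σ : Matrix X X ℂ) : ℝ :=
  (CFC.sqrt (CFC.sqrt ρ * σ * CFC.sqrt ρ)).trace.re ^ 2

/-- The projector `|x⟩⟨x|` onto a basis state. -/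
def basisState {X : Type} [DecidableEq X] (x : X) : Matrix X X ℂ :=
  Matrix.single x x 1

/-- Product of a state of the register `ι` with a state of the register `κ`. -/
def joint {ι κ : Type} (ρ : Matrix (Bits ι) (Bits ι) ℂ) (σ : Matrix (Bits κ) (Bits κ) ℂ) :
    Matrix (Bits (ι ⊕ κ)) (Bits (ι ⊕ κ)) ℂ :=
  Matrix.of fun x y =>
    ρ (fun i => x (Sum.inl i)) (fun i => y (Sum.inl i)) *
      σ (fun k => x (Sum.inr k)) (fun k => y (Sum.inr k))

/-- `p` copies of a bipartite operator, as an operator on all `p * (a + b)` qubits: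
qubit `(i, Sum.inl j)` is the `j`-th qubit of `A` in the `i`-th copy, and
qubit `(i, Sum.inr j)` is the `j`-th qubit of `B` in the `i`-th copy. -/
def copies (p : ℕ) {a b : ℕ}
    (ρ : Matrix (Bits (Fin a) × Bits (Fin b)) (Bits (Fin a) × Bits (Fin b)) ℂ) :
    Matrix (Bits (Fin p × (Fin a ⊕ Fin b))) (Bits (Fin p × (Fin a ⊕ Fin b))) ℂ :=
  Matrix.of fun x y => ∏ i : Fin p,
    ρ (fun j => x (i, Sum.inl j), fun j => x (i, Sum.inr j))
      (fun j => y (i, Sum.inl j), fun j => y (i, Sum.inr j))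

/-- One EPR pair `|Φ⁺⟩⟨Φ⁺|`, where `|Φ⁺⟩ = (|00⟩ + |11⟩) / √2`. -/
def eprPair : Matrix (Bool × Bool) (Bool × Bool) ℂ :=
  Matrix.of fun x y => if x.1 = x.2 ∧ y.1 = y.2 then 1 / 2 else 0

/-- `m` EPR pairs, party `A` holding the first and party `B` the second qubit of each. -/
def eprPairs (m : ℕ) :
    Matrix (Bits (Fin m) × Bits (Fin m)) (Bits (Fin m) × Bits (Fin m)) ℂ :=
  Matrix.of fun x y => ∏ i : Fin m, eprPair (x.1 i, x.2 i) (y.1 i, y.2 i)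

/-! ### Generalized quantum circuits over the gate set Hadamard, T, CNOT -/

/-- Gates on `N` wires from the discrete universal gate set `{H, T, CNOT}`. -/
inductive Gate (N : ℕ) : Type
  | had (w : Fin N) : Gate N
  | tee (w : Fin N) : Gate N
  | cnot (c t : Fin N) (h : c ≠ t) : Gate N

/-- The unitary of a gate, acting as the identity on the wires it does not touch. -/
def Gate.mat {N : ℕ} : Gate N → Matrix (Bits (Fin N)) (Bits (Fin N)) ℂ
  | .had w => Matrix.of fun x y =>
      if ∀ v, v ≠ w → x v = y v then (if x w && y w then -1 else 1) / (Real.sqrt 2 : ℂ) else 0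
  | .tee w => Matrix.diagonal fun x =>
      if x w then Complex.exp (Complex.I * (Real.pi / 4 : ℝ)) else 1
  | .cnot c t _ => Matrix.of fun x y =>
      if x = Function.update y t (xor (y t) (y c)) then 1 else 0

/-- The product of a list of gates, the head of the list being applied first. -/
def gatesMat {N : ℕ} : List (Gate N) → Matrix (Bits (Fin N)) (Bits (Fin N)) ℂ
  | [] => 1
  | g :: gs => gatesMat gs * g.mat

/-- A generalized quantum circuit from the register `ι` to the register `ο`. Every wire is either
an input or one of `zeros` wires initialized to `|0⟩`; then the gates are applied; then every
wire is either an output or one of `traced` wires that are traced out. -/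
structure GenCircuit (ι ο : Type) where
  wires : ℕ
  zeros : ℕ
  traced : ℕ
  inp : ι ⊕ Fin zeros ≃ Fin wires
  out : ο ⊕ Fin traced ≃ Fin wires
  gates : List (Gate wires)

namespace GenCircuit

variable {ι ο : Type}

/-- The size of a circuit: the number of its gates and wires. -/
def size (C : GenCircuit ι ο) : ℕ := C.gates.length + C.wires

/-- The Kraus operator `⟨t| U (· ⊗ |0…0⟩)`, where `U` is the unitary part of the circuit and `t`
a basis state of the wires that are traced out. -/
def kraus (C : GenCircuit ι ο) (t : Bits (Fin C.traced)) : Matrix (Bits ο) (Bits ι) ℂ :=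
  (gatesMat C.gates).submatrix
    (fun u w => Sum.elim u t (C.out.symm w))
    (fun z w => Sum.elim z (fun _ => false) (C.inp.symm w))

/-- The channel that a generalized circuit implements. -/
def run [Fintype ι] [DecidableEq ι] (C : GenCircuit ι ο) (ρ : Matrix (Bits ι) (Bits ι) ℂ) :
    Matrix (Bits ο) (Bits ο) ℂ :=
  ∑ t, C.kraus t * ρ * (C.kraus t).conjTranspose

end GenCircuit

/-- Auxiliary: two basis states agree with `x` away from `w`. -/
theorem sum_agree {N : ℕ} (w : Fin N) (x : Bits (Fin N)) (f : Bits (Fin N) → ℂ) :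
    (∑ z, if (∀ v, v ≠ w → z v = x v) then f z else 0)
      = f (Function.update x w false) + f (Function.update x w true) := by
  rw [← Finset.sum_filter]
  have h : (Finset.univ.filter fun z : Bits (Fin N) => ∀ v, v ≠ w → z v = x v)
      = {Function.update x w false, Function.update x w true} := by
    ext z
    simp only [Finset.mem_filter, Finset.mem_univ, true_and, Finset.mem_insert,
      Finset.mem_singleton]
    constructor
    · intro hz
      cases hw : z w
      · left
        funext v
        by_cases hv : v = w
        · subst hv; simp [hw]
        · simp [hv, hz v hv]
      · right
        funext v
        by_cases hv : v = w
        · subst hv; simp [hw]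
        · simp [hv, hz v hv]
    · rintro (rfl | rfl) v hv <;> simp [hv]
  rw [h, Finset.sum_pair]
  intro hc
  have := congrFun hc w
  simp at this

theorem Gate.mat_unitary {N : ℕ} (g : Gate N) : g.mat.conjTranspose * g.mat = 1 := by
  cases g with
  | had w =>
    ext x y
    have hs : ((Real.sqrt 2 : ℝ) : ℂ) * ((Real.sqrt 2 : ℝ) : ℂ) = 2 := by
      rw [← Complex.ofReal_mul, Real.mul_self_sqrt (by norm_num)]; norm_num
    have hs0 : ((Real.sqrt 2 : ℝ) : ℂ) ≠ 0 := by
      intro h; rw [h] at hs; norm_num at hs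
    have e : (Gate.mat (.had w)).conjTranspose * Gate.mat (.had w)
        = Matrix.of fun x y => ∑ z : Bits (Fin N), if (∀ v, v ≠ w → z v = x v) then
          (if ∀ v, v ≠ w → z v = y v then
            (if z w && x w then (-1 : ℂ) else 1) / (Real.sqrt 2 : ℂ) *
            ((if z w && y w then -1 else 1) / (Real.sqrt 2 : ℂ)) else 0) else 0 := by
      ext x y
      simp only [Gate.mat, Matrix.mul_apply, Matrix.conjTranspose_apply, Matrix.of_apply]
      refine Finset.sum_congr rfl fun z _ => ?_
      by_cases h1 : ∀ v, v ≠ w → z v = x v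
      · by_cases h2 : ∀ v, v ≠ w → z v = y v
        · rw [if_pos h1, if_pos h2, if_pos h1, if_pos h2]
          congr 1
          split_ifs <;> simp
        · rw [if_neg h2, if_neg h2]; simp
      · rw [if_neg h1, if_neg h1]; simp
    rw [e, Matrix.of_apply, sum_agree]
    by_cases h : ∀ v, v ≠ w → x v = y v
    · have h0 : ∀ b : Bool, ∀ v, v ≠ w → Function.update x w b v = y v := by
        intro b v hv; simp [hv, h v hv]
      rw [if_pos (h0 _), if_pos (h0 _)]
      by_cases hw : x w = y w
      · have hxy : x = y := by
          funext v
          by_cases hv : v = w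
          · rw [hv, hw]
          · exact h v hv
        subst hxy
        cases x w <;> simp <;> field_simp <;> rw [sq, hs] <;> norm_num
      · have hxy : x ≠ y := fun h' => hw (by rw [h'])
        rw [Matrix.one_apply_ne hxy]
        cases hx : x w <;> cases hy : y w <;> simp_all <;> ring
    · have hxy : x ≠ y := fun h' => h (fun v _ => by rw [h'])
      have h0 : ∀ b : Bool, ¬ ∀ v, v ≠ w → Function.update x w b v = y v := by
        intro b hb
        apply h
        intro v hv
        have := hb v hv
        simpa [hv] using this
      rw [if_neg (h0 _), if_neg (h0 _), Matrix.one_apply_ne hxy, add_zero]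
  | tee w =>
    simp only [Gate.mat, Matrix.diagonal_conjTranspose, Matrix.diagonal_mul_diagonal]
    rw [← Matrix.diagonal_one]
    congr 1
    funext x
    by_cases h : x w
    · simp only [h, Pi.star_apply, if_true]
      rw [RCLike.star_def, ← Complex.exp_conj, ← Complex.exp_add, map_mul, Complex.conj_I,
        Complex.conj_ofReal]
      simp
    · simp [h]
  | cnot c t h =>
    ext x y
    have hinv : ∀ x y : Bits (Fin N),
        Function.update x t (xor (x t) (x c)) = Function.update y t (xor (y t) (y c)) →
        x = y := by
      intro x y hxy
      have hv : ∀ v, v ≠ t → x v = y v := by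
        intro v hv
        have := congrFun hxy v
        simpa [hv] using this
      have ht := congrFun hxy t
      simp only [Function.update_self] at ht
      rw [hv c h] at ht
      funext v
      by_cases hvt : v = t
      · subst hvt
        simpa using ht
      · exact hv v hvt
    simp only [Gate.mat, Matrix.mul_apply, Matrix.conjTranspose_apply, Matrix.of_apply]
    rw [Finset.sum_eq_single (Function.update x t (xor (x t) (x c)))]
    · by_cases hxy : x = y
      · subst hxy; simp
      · rw [Matrix.one_apply_ne hxy, if_neg (fun h' => hxy (hinv _ _ h'))]; simp
    · intro z _ hz
      rw [if_neg hz]; simp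
    · simp

theorem gatesMat_unitary {N : ℕ} (gs : List (Gate N)) :
    (gatesMat gs).conjTranspose * gatesMat gs = 1 := by
  induction gs with
  | nil => simp [gatesMat]
  | cons g gs ih =>
    rw [gatesMat, Matrix.conjTranspose_mul, Matrix.mul_assoc,
      ← Matrix.mul_assoc _ (gatesMat gs), ih, Matrix.one_mul, g.mat_unitary]

theorem GenCircuit.kraus_complete {ι ο : Type} [Fintype ο] [DecidableEq ο] [DecidableEq ι]
    [Fintype ι] (C : GenCircuit ι ο) : ∑ t, (C.kraus t).conjTranspose * C.kraus t = 1 := by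
  ext z z'
  let e : Bits (Fin C.traced) × Bits ο ≃ Bits (Fin C.wires) :=
    (Equiv.prodComm _ _).trans
      ((Equiv.sumArrowEquivProdArrow ο (Fin C.traced) Bool).symm.trans
        (Equiv.arrowCongr C.out (Equiv.refl Bool)))
  have he : ∀ t u, e (t, u) = fun w => Sum.elim u t (C.out.symm w) := fun t u => rfl
  have key := congrFun (congrFun (gatesMat_unitary C.gates)
    (fun w => Sum.elim z (fun _ => false) (C.inp.symm w)))
    (fun w => Sum.elim z' (fun _ => false) (C.inp.symm w))
  rw [Matrix.mul_apply, ← e.sum_comp, Fintype.sum_prod_type] at key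
  simp only [Matrix.sum_apply, Matrix.mul_apply, Matrix.conjTranspose_apply, kraus,
    Matrix.submatrix_apply] at key ⊢
  simp only [he] at key
  rw [key, Matrix.one_apply, Matrix.one_apply]
  congr 1
  apply propext
  constructor
  · intro h
    funext i
    have := congrFun h (C.inp (Sum.inl i))
    simpa using this
  · rintro rfl
    rfl

/-! ### LOCC maps

Local quantum systems are qubit registers and classical messages are bit strings; every
finite-dimensional system and every finite alphabet embeds into such. -/

/-- A quantum channel from `a` qubits to `a'` qubits and `x` classical bits (a quantum
instrument), given by Kraus operators: `kraus u e` is the `e`-th Kraus operator of the branch with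
classical output `u`. -/
structure Instrument (a a' x : ℕ) where
  env : ℕ
  kraus : Bits (Fin x) → Bits (Fin env) → Matrix (Bits (Fin a')) (Bits (Fin a)) ℂ
  complete : ∑ u, ∑ e, (kraus u e).conjTranspose * kraus u e = 1

/-- LOCC protocols with `a'`, `b'` output qubits, indexed by the numbers `a`, `b` of input qubits.
In each of finitely many rounds both parties apply a channel with quantum and classical output
and send each other the classical outputs, on which all that follows may depend. -/
inductive LOCC (a' b' : ℕ) : ℕ → ℕ → Type
  | done : LOCC a' b' a' b'
  | round {a b a₁ b₁ x y : ℕ} (IA : Instrument a a₁ x) (IB : Instrument b b₁ y)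
      (next : Bits (Fin x) → Bits (Fin y) → LOCC a' b' a₁ b₁) : LOCC a' b' a b

/-- The map on operators that an LOCC protocol implements. -/
def LOCC.apply {a' b' : ℕ} : {a b : ℕ} → LOCC a' b' a b →
    Matrix (Bits (Fin a) × Bits (Fin b)) (Bits (Fin a) × Bits (Fin b)) ℂ →
    Matrix (Bits (Fin a') × Bits (Fin b')) (Bits (Fin a') × Bits (Fin b')) ℂ
  | _, _, .done, ρ => ρ
  | _, _, .round IA IB next, ρ =>
      ∑ u, ∑ v, (next u v).apply
        (∑ e, ∑ f, (IA.kraus u e ⊗ₖ IB.kraus v f) * ρ *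
          (IA.kraus u e ⊗ₖ IB.kraus v f).conjTranspose)

/-- The instrument of a party that runs a generalized circuit on its `a` qubits and on a classical
register `κ` with contents `s`, keeps `a'` output qubits, and measures the other `x` output
qubits in the computational basis. -/
def GenCircuit.instrument {κ : Type} [Fintype κ] [DecidableEq κ] {a a' x : ℕ}
    (C : GenCircuit (Fin a ⊕ κ) (Fin a' ⊕ Fin x)) (s : Bits κ) : Instrument a a' x where
  env := C.traced
  kraus u e := (C.kraus e).submatrix (fun r => Sum.elim r u) (fun z => Sum.elim z s)
  complete := by
    ext z z'
    have key := congrFun (congrFun C.kraus_complete (Sum.elim z s)) (Sum.elim z' s)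
    simp only [Matrix.sum_apply, Matrix.mul_apply, Matrix.conjTranspose_apply,
      Matrix.submatrix_apply] at key ⊢
    rw [Finset.sum_comm]
    have h : ∀ e, (∑ u : Bits (Fin x), ∑ r : Bits (Fin a'),
        star (C.kraus e (Sum.elim r u) (Sum.elim z s)) *
          C.kraus e (Sum.elim r u) (Sum.elim z' s))
        = ∑ w, star (C.kraus e w (Sum.elim z s)) * C.kraus e w (Sum.elim z' s) := by
      intro e
      rw [← (Equiv.sumArrowEquivProdArrow (Fin a') (Fin x) Bool).symm.sum_comp,
        Fintype.sum_prod_type, Finset.sum_comm]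
      rfl
    simp only [h]
    rw [key, Matrix.one_apply, Matrix.one_apply]
    congr 1
    apply propext
    constructor
    · intro h
      funext i
      have := congrFun h (Sum.inl i)
      simpa using this
    · rintro rfl
      rfl

/-- LOCC protocols made of generalized quantum circuits. Here `x`, `y` are the numbers of bits that
`A`, `B` sent in the previous round; these bits form a classical register that both circuits of
the round may read. -/
inductive CircuitLOCC (a' b' : ℕ) : ℕ → ℕ → ℕ → ℕ → Type
  | done {x y : ℕ} : CircuitLOCC a' b' a' b' x y
  | round {a b x y a₁ b₁ x₁ y₁ : ℕ}
      (CA : GenCircuit (Fin a ⊕ (Fin x ⊕ Fin y)) (Fin a₁ ⊕ Fin x₁))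
      (CB : GenCircuit (Fin b ⊕ (Fin x ⊕ Fin y)) (Fin b₁ ⊕ Fin y₁))
      (next : CircuitLOCC a' b' a₁ b₁ x₁ y₁) : CircuitLOCC a' b' a b x y

/-- The LOCC protocol that is described by circuits, given the current contents of the classical
register. -/
def CircuitLOCC.toLOCC {a' b' : ℕ} : {a b x y : ℕ} → CircuitLOCC a' b' a b x y →
    Bits (Fin x ⊕ Fin y) → LOCC a' b' a b
  | _, _, _, _, .done, _ => .done
  | _, _, _, _, .round CA CB next, s =>
      .round (CA.instrument s) (CB.instrument s) fun u v => next.toLOCC (Sum.elim u v)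

/-- The size of the circuit description: all gates and wires, and one for each round. -/
def CircuitLOCC.size {a' b' : ℕ} : {a b x y : ℕ} → CircuitLOCC a' b' a b x y → ℕ
  | _, _, _, _, .done => 0
  | _, _, _, _, .round CA CB next => CA.size + CB.size + next.size + 1

/-- The map of a circuit LOCC protocol that starts with an empty classical register. -/
def CircuitLOCC.apply {a' b' a b : ℕ} (Γ : CircuitLOCC a' b' a b 0 0)
    (ρ : Matrix (Bits (Fin a) × Bits (Fin b)) (Bits (Fin a) × Bits (Fin b)) ℂ) :
    Matrix (Bits (Fin a') × Bits (Fin b')) (Bits (Fin a') × Bits (Fin b')) ℂ :=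
  (Γ.toLOCC fun _ => false).apply ρ

/-! ### Entanglement measures -/

/-- One-shot distillable entanglement `E_D^ε`. -/
def distillableEntanglement {a b : ℕ} (ε : ℝ) (ρ : BipartiteState a b) : ℝ≥0∞ :=
  ⨆ (m : ℕ) (_ : ∃ Γ : LOCC m m a b, 1 - ε ≤ fidelity (Γ.apply ρ.mat) (eprPairs m)), (m : ℝ≥0∞)

/-- One-shot entanglement cost `E_C^ε`. -/
def entanglementCost {a b : ℕ} (ε : ℝ) (ρ : BipartiteState a b) : ℝ≥0∞ :=
  ⨅ (n : ℕ) (_ : ∃ Γ : LOCC a b n n, 1 - ε ≤ fidelity (Γ.apply (eprPairs n)) ρ.mat), (n : ℝ≥0∞)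

/-- The computational one-shot entanglement cost of the family `ρ` with error `ε` is at most `n`:
an efficient family of LOCC maps prepares `ρ l` from `n l` EPR pairs up to error `ε l`. -/
def CompEntanglementCostLE {a b : ℕ → ℕ} (ε : ℕ → ℝ) (ρ : ∀ l, BipartiteState (a l) (b l))
    (n : ℕ → ℕ) : Prop :=
  ∃ Γ : ∀ l, CircuitLOCC (a l) (b l) (n l) (n l) 0 0,
    PolyBounded (fun l => (Γ l).size) ∧
    ∀ l, 1 - ε l ≤ fidelity ((Γ l).apply (eprPairs (n l))) (ρ l).mat

/-- Candidate entanglement measures `E^ε` of bipartite states, with error parameter `ε`. -/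
abbrev EntanglementMeasure : Type := ∀ a b : ℕ, ℝ → BipartiteState a b → ℝ≥0∞

/-! ### Computational indistinguishability -/

/-- A non-uniform quantum polynomial-time distinguisher for families of states of the registers
`ι l`: polynomial-size circuits that take the state and an advice register to one output qubit. -/
structure Distinguisher (ι : ℕ → Type) where
  advice : ℕ → ℕ
  circuit : ∀ l, GenCircuit (ι l ⊕ Fin (advice l)) (Fin 1)
  polySize : PolyBounded fun l => (circuit l).size

/-- The probability that the distinguisher outputs `1` on the state `ρ` with advice `α`. -/
def Distinguisher.prob {ι : ℕ → Type} [∀ l, Fintype (ι l)] [∀ l, DecidableEq (ι l)]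
    (D : Distinguisher ι) (l : ℕ) (α : DensityMatrix (Bits (Fin (D.advice l))))
    (ρ : Matrix (Bits (ι l)) (Bits (ι l)) ℂ) : ℝ :=
  ((D.circuit l).run (joint ρ α.mat) (fun _ => true) (fun _ => true)).re

/-- Computational indistinguishability against non-uniform quantum polynomial-time distinguishers
with arbitrary quantum advice. -/
def CompIndistinguishable {ι : ℕ → Type} [∀ l, Fintype (ι l)] [∀ l, DecidableEq (ι l)]
    (ρ σ : ∀ l, Matrix (Bits (ι l)) (Bits (ι l)) ℂ) : Prop :=
  ∀ D : Distinguisher ι, ∃ μ : ℕ → ℝ, Negligible μ ∧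
    ∀ l, ∀ α : DensityMatrix (Bits (Fin (D.advice l))),
      |D.prob l α (ρ l) - D.prob l α (σ l)| ≤ μ l

/-! ### Uniform quantum polynomial-time algorithms and EFI pairs -/

/-- Numbers that describe a gate. -/
def Gate.code {N : ℕ} : Gate N → List ℕ
  | .had w => [0, w]
  | .tee w => [1, w]
  | .cnot c t _ => [2, c, t]

/-- Description of a circuit as a bit string: the numbers of wires, of zero-initialized wires and
of traced-out wires, the positions of the inputs, zero-initialized wires, outputs and
traced-out wires, and the gates in their order, each number in unary and ended by `false`. -/
def GenCircuit.describe {i o : ℕ} (C : GenCircuit (Fin i) (Fin o)) : List Bool :=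
  ([C.wires, C.zeros, C.traced] ++
    List.ofFn (fun j => (C.inp (Sum.inl j)).val) ++
    List.ofFn (fun j => (C.inp (Sum.inr j)).val) ++
    List.ofFn (fun j => (C.out (Sum.inl j)).val) ++
    List.ofFn (fun j => (C.out (Sum.inr j)).val) ++
    C.gates.flatMap Gate.code).flatMap fun k => List.replicate k true ++ [false]

/-- A uniform quantum polynomial-time algorithm: circuits of polynomial size whose description is
computed from `1^l` by a polynomial-time Turing machine. -/
def IsUniformQPT {i o : ℕ → ℕ} (A : ∀ l, GenCircuit (Fin (i l)) (Fin (o l))) : Prop :=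
  PolyBounded (fun l => (A l).size) ∧
  Nonempty (Turing.TM2ComputableInPolyTime (fun l : ℕ => List.replicate l true)
    (fun s : List Bool => s) (fun l => (A l).describe))

/-- EFI pairs: efficiently generated, statistically far, computationally indistinguishable.
On input `(1^l, b)` the generator is given the basis state of the bit `b`. -/
structure IsEFIPair {m : ℕ → ℕ} (ρ₀ ρ₁ : ∀ l, DensityMatrix (Bits (Fin (m l)))) : Prop where
  efficient : ∃ A : ∀ l, GenCircuit (Fin 1) (Fin (m l)), IsUniformQPT A ∧
    ∀ l, (A l).run (basisState fun _ => false) = (ρ₀ l).mat ∧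
      (A l).run (basisState fun _ => true) = (ρ₁ l).mat
  far : ∃ P : Polynomial ℝ, (∀ l : ℕ, 0 < P.eval (l : ℝ)) ∧
    ∀ l : ℕ, 1 / P.eval (l : ℝ) ≤ traceDistance (ρ₀ l).mat (ρ₁ l).mat
  indistinguishable : CompIndistinguishable (fun l => (ρ₀ l).mat) (fun l => (ρ₁ l).mat)

end PseudoEnt

end

noncomputable section

namespace PseudoEnt

/-! Both families are instances of one construction, `codeState`. Choose `z` uniformly in `{0,1}^q`,
let the parties share the Bell states `(|00⟩ + (-1)^{z_j}|11⟩)/√2`, and give `A` in addition `t`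
copies of an EFI state for every `j`. In `φ` these copies are `ρ_{z_j}`, so they encode the phases;
in `ψ` they are always `ρ_0`. Thus `A` holds `q t m + q = q (t m + 1)` qubits.

In `ψ` nothing records `z`. Averaging over it dephases each Bell state into a pair of equal
classical bits (`sum_mul_ebits`), so `ψ` is separable: `B` tosses `q` coins and announces them, and
`A` runs the generator of `ρ_0` (`prepProtocol_apply_eq`). This costs no EPR pair and makes no
error.

In `φ` the first party measures every copy in the eigenbasis of `ρ_0 - ρ_1`, where the outcome
distributions are as far apart as the states (`exists_unitary_traceDistance`). With `δ` the trace
distance, maximum likelihood on `t` samples errs with probability at most `½ exp(-t δ²/2)`, because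
the Bhattacharyya coefficient is multiplicative (`exists_guess`). A local phase flip then restores
the EPR pairs, and the fidelity is exactly the probability that all guesses are right
(`fidelity_distillProtocol`). As `δ` is at least an inverse polynomial, a polynomial `t` gives error
at most `q · ½ e^{-2λ}` (`exists_distillation`).

Indistinguishability is a hybrid argument over the `p q t` copies of EFI states. For fixed phases,
two neighbouring hybrids differ in one such state, and all the other qubits can be handed to the EFI
distinguisher as quantum advice (`joint_otherState`). The bound survives averaging over the phases
by linearity (`compIndistinguishable_copies`). -/

/-! ### Tensor products of matrices over a finite index set -/

/-- The tensor product of a finite family of matrices. -/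
def piMat {S X Y : Type} [Fintype S] (M : S → Matrix X Y ℂ) : Matrix (S → X) (S → Y) ℂ :=
  Matrix.of fun x y => ∏ s, M s (x s) (y s)

section PiMat

variable {S X Y W : Type} [Fintype S]

theorem piMat_apply (M : S → Matrix X Y ℂ) (x : S → X) (y : S → Y) :
    piMat M x y = ∏ s, M s (x s) (y s) := rfl

theorem sum_prod_pi [DecidableEq S] [Fintype X] {R : Type} [CommSemiring R] (f : S → X → R) :
    ∑ x : S → X, ∏ s, f s (x s) = ∏ s, ∑ a, f s a := by
  rw [Finset.prod_univ_sum, Fintype.piFinset_univ]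

theorem piMat_mul [DecidableEq S] [Fintype Y] (M : S → Matrix X Y ℂ) (N : S → Matrix Y W ℂ) :
    piMat M * piMat N = piMat fun s => M s * N s := by
  ext x y
  simp only [Matrix.mul_apply, piMat_apply, ← Finset.prod_mul_distrib]
  exact sum_prod_pi fun s a => M s (x s) a * N s a (y s)

theorem conjTranspose_piMat (M : S → Matrix X Y ℂ) :
    (piMat M).conjTranspose = piMat fun s => (M s).conjTranspose := by
  ext x y
  simp [piMat_apply, Matrix.conjTranspose_apply]

theorem trace_piMat [DecidableEq S] [Fintype X] (M : S → Matrix X X ℂ) :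
    (piMat M).trace = ∏ s, (M s).trace := by
  simp only [Matrix.trace, Matrix.diag_apply, piMat_apply]
  exact sum_prod_pi fun s a => M s a a

theorem piMat_one [DecidableEq X] : piMat (fun _ : S => (1 : Matrix X X ℂ)) = 1 := by
  ext x y
  rw [piMat_apply]
  by_cases h : x = y
  · subst h; simp
  · obtain ⟨s, hs⟩ := Function.ne_iff.mp h
    rw [Matrix.one_apply_ne h]
    exact Finset.prod_eq_zero (Finset.mem_univ s) (Matrix.one_apply_ne hs)

/-- The product of the square roots exhibits the product as `R† R`. -/
theorem posSemidef_piMat [DecidableEq S] [Fintype X] [DecidableEq X] {M : S → Matrix X X ℂ}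
    (hM : ∀ s, (M s).PosSemidef) : (piMat M).PosSemidef := by
  have h : piMat M = (piMat fun s => CFC.sqrt (M s)).conjTranspose * piMat fun s => CFC.sqrt (M s)
      := by
    rw [conjTranspose_piMat, piMat_mul]
    congr 1
    funext s
    rw [(Matrix.nonneg_iff_posSemidef.mp (CFC.sqrt_nonneg (M s))).isHermitian.eq,
        CFC.sqrt_mul_sqrt_self _ (hM s).nonneg]
  rw [h]
  exact Matrix.posSemidef_conjTranspose_mul_self _

end PiMat

/-! ### Constructions of density matrices -/

namespace DensityMatrix

variable {X Y S Z : Type} [Fintype X] [Fintype Y] [Fintype S] [Fintype Z]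

/-- Renaming of the basis. -/
def reindex (e : X ≃ Y) (ρ : DensityMatrix X) : DensityMatrix Y where
  mat := ρ.mat.submatrix e.symm e.symm
  posSemidef := ρ.posSemidef.submatrix _
  trace_eq_one := by
    rw [← ρ.trace_eq_one]
    exact e.symm.sum_comp fun x => ρ.mat x x

/-- Product states. -/
def kron [DecidableEq X] [DecidableEq Y] (ρ : DensityMatrix X) (σ : DensityMatrix Y) :
    DensityMatrix (X × Y) where
  mat := ρ.mat ⊗ₖ σ.mat
  posSemidef := ρ.posSemidef.kronecker σ.posSemidef
  trace_eq_one := by rw [Matrix.trace_kronecker, ρ.trace_eq_one, σ.trace_eq_one, one_mul]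

/-- Product states of a finite family. -/
def pi [DecidableEq S] [DecidableEq X] (ρ : S → DensityMatrix X) : DensityMatrix (S → X) where
  mat := piMat fun s => (ρ s).mat
  posSemidef := posSemidef_piMat fun s => (ρ s).posSemidef
  trace_eq_one := by rw [trace_piMat]; simp [trace_eq_one]

/-- The pure state of a unit vector. -/
def pure (v : X → ℂ) (hv : ∑ x, v x * star (v x) = 1) : DensityMatrix X where
  mat := Matrix.vecMulVec v (star v)
  posSemidef := Matrix.posSemidef_vecMulVec_self_star v
  trace_eq_one := by rw [Matrix.trace_vecMulVec, dotProduct]; exact hv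

/-- The uniform mixture of a finite family of states. -/
def mix [Nonempty Z] (ρ : Z → DensityMatrix X) : DensityMatrix X where
  mat := ((Fintype.card Z : ℝ)⁻¹ : ℂ) • ∑ z, (ρ z).mat
  posSemidef := (Matrix.posSemidef_sum _ fun z _ => (ρ z).posSemidef).smul (by positivity)
  trace_eq_one := by
    rw [Matrix.trace_smul, Matrix.trace_sum]
    simp [trace_eq_one]

end DensityMatrix

/-! ### Fidelity -/

theorem fidelity_self {X : Type} [Fintype X] [DecidableEq X] (ρ : DensityMatrix X) :
    fidelity ρ.mat ρ.mat = 1 := by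
  have h0 := ρ.posSemidef.nonneg
  have h1 : CFC.sqrt ρ.mat * ρ.mat * CFC.sqrt ρ.mat = ρ.mat * ρ.mat := by
    have h2 := CFC.sqrt_mul_sqrt_self ρ.mat h0
    generalize CFC.sqrt ρ.mat = R at h2
    rw [← h2]
    simp only [mul_assoc]
  rw [fidelity, h1, CFC.sqrt_unique rfl h0, ρ.trace_eq_one]
  simp

/-- With `w = √ρ v`, the matrix under the outer root is `|w⟩⟨w|`, whose root is `|w⟩⟨w| / ‖w‖` and
has trace `‖w‖`. Squaring gives `‖w‖² = ⟨v, ρ v⟩`. -/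
theorem fidelity_pure {X : Type} [Fintype X] [DecidableEq X] {ρ : Matrix X X ℂ}
    (hρ : ρ.PosSemidef) (v : X → ℂ) :
    fidelity ρ (Matrix.vecMulVec v (star v)) = (star v ⬝ᵥ ρ.mulVec v).re := by
  have h0 := hρ.nonneg
  set R := CFC.sqrt ρ with hR
  have hRH : R.conjTranspose = R := (Matrix.nonneg_iff_posSemidef.mp (CFC.sqrt_nonneg
      ρ)).isHermitian.eq
  set w := R.mulVec v with hw
  have h1 : R * Matrix.vecMulVec v (star v) * R = Matrix.vecMulVec w (star w) := by
    rw [Matrix.mul_vecMulVec, Matrix.vecMulVec_mul, hw, Matrix.star_mulVec, hRH]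
  have h2 : star v ⬝ᵥ ρ.mulVec v = star w ⬝ᵥ w := by
    rw [hw, Matrix.star_mulVec, hRH, ← Matrix.dotProduct_mulVec, Matrix.mulVec_mulVec,
      CFC.sqrt_mul_sqrt_self ρ h0]
  have hc0 : 0 ≤ star w ⬝ᵥ w := dotProduct_star_self_nonneg w
  have hcr : star w ⬝ᵥ w = ((star w ⬝ᵥ w).re : ℂ) := by
    rw [← Complex.eq_re_of_ofReal_le hc0]
  have hre : 0 ≤ (star w ⬝ᵥ w).re := (Complex.le_def.mp hc0).1
  rw [fidelity, h1, h2]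
  generalize hc : (star w ⬝ᵥ w).re = c at hcr hre ⊢
  have h3 : CFC.sqrt (Matrix.vecMulVec w (star w)) =
      ((Real.sqrt c)⁻¹ : ℂ) • Matrix.vecMulVec w (star w) := by
    apply CFC.sqrt_unique
    · rw [Matrix.smul_mul, Matrix.mul_smul, Matrix.vecMulVec_mul_vecMulVec, hcr]
      -- For `c = 0` the factor `(√c)⁻¹` is `0` by convention, which is harmless because then `w =
      -- 0`.
      rcases eq_or_lt_of_le hre with h | h
      · have hw0 : w = 0 := dotProduct_star_self_eq_zero.mp (by rw [hcr, ← h]; simp)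
        rw [hw0]; simp
      · rw [Matrix.vecMulVec_smul, smul_smul, smul_smul]
        have : ((Real.sqrt c : ℂ)⁻¹ * (Real.sqrt c : ℂ)⁻¹ * (c : ℂ)) = 1 := by
          norm_cast
          have h5 := Real.mul_self_sqrt hre
          have h6 := (Real.sqrt_pos.mpr h).ne'
          field_simp
          rw [sq, h5]
        rw [this, one_smul]
    · refine ((Matrix.posSemidef_vecMulVec_self_star w).smul ?_).nonneg
      norm_cast
      positivity
  rw [h3, Matrix.trace_smul, Matrix.trace_vecMulVec, dotProduct_comm, hcr]
  rw [smul_eq_mul, ← Complex.ofReal_inv, ← Complex.ofReal_mul, Complex.ofReal_re]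
  rcases eq_or_lt_of_le hre with h | h
  · rw [← h]; simp
  · have h5 := Real.mul_self_sqrt hre
    have h6 := (Real.sqrt_pos.mpr h).ne'
    rw [mul_pow, inv_pow, sq (Real.sqrt c), h5]
    field_simp

/-! ### Measurement in the eigenbasis of a difference of states -/

/-- The probability of outcome `j` when `ρ` is rotated by `U` and measured. -/
def outcomeProb {X : Type} [Fintype X] (U ρ : Matrix X X ℂ) (j : X) : ℝ :=
  ((U * ρ * U.conjTranspose) j j).re

section OutcomeProb

variable {X : Type} [Fintype X] {U ρ : Matrix X X ℂ}

theorem outcomeProb_ofReal (hρ : ρ.PosSemidef) (j : X) :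
    (U * ρ * U.conjTranspose) j j = (outcomeProb U ρ j : ℂ) := by
  have h : 0 ≤ (U * ρ * U.conjTranspose) j j := (hρ.mul_mul_conjTranspose_same U).diag_nonneg
  exact (Complex.eq_re_of_ofReal_le h)

theorem outcomeProb_nonneg (hρ : ρ.PosSemidef) (j : X) : 0 ≤ outcomeProb U ρ j :=
  (Complex.le_def.mp (hρ.mul_mul_conjTranspose_same U).diag_nonneg).1

theorem sum_outcomeProb [DecidableEq X] (hU : U.conjTranspose * U = 1) (ρ : DensityMatrix X) :
    ∑ j, outcomeProb U ρ.mat j = 1 := by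
  have h : (U * ρ.mat * U.conjTranspose).trace = 1 := by
    rw [Matrix.trace_mul_comm, ← Matrix.mul_assoc, hU, Matrix.one_mul, ρ.trace_eq_one]
  have := congrArg Complex.re h
  simpa [Matrix.trace, outcomeProb] using this

end OutcomeProb

/-- In an eigenbasis of `ρ - σ` with eigenvalues `d j`, the outcome probabilities differ by exactly
`d j`, and `|ρ - σ|` is diagonal there with entries `|d j|`. This reduces the discrimination of the
states to that of classical distributions. -/
theorem exists_unitary_traceDistance {X : Type} [Fintype X] [DecidableEq X]
    {ρ σ : Matrix X X ℂ} (hρ : ρ.IsHermitian) (hσ : σ.IsHermitian) :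
    ∃ U : Matrix X X ℂ, U.conjTranspose * U = 1 ∧
      ∑ j, |outcomeProb U ρ j - outcomeProb U σ j| = 2 * traceDistance ρ σ := by
  have hD : (ρ - σ).IsHermitian := hρ.sub hσ
  set V : Matrix X X ℂ := (hD.eigenvectorUnitary : Matrix X X ℂ) with hV
  have hVV : V.conjTranspose * V = 1 := Unitary.coe_star_mul_self hD.eigenvectorUnitary
  have hVV' : V * V.conjTranspose = 1 := Unitary.coe_mul_star_self hD.eigenvectorUnitary
  set d := hD.eigenvalues with hd
  have hspec : ρ - σ = V * Matrix.diagonal (fun j => (d j : ℂ)) * V.conjTranspose := by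
    conv_lhs => rw [hD.spectral_theorem, Unitary.conjStarAlgAut_apply]
    rfl
  have hdiag : V.conjTranspose * (ρ - σ) * V = Matrix.diagonal (fun j => (d j : ℂ)) := by
    rw [hspec]
    calc _ = (V.conjTranspose * V) * Matrix.diagonal (fun j => (d j : ℂ)) *
          (V.conjTranspose * V) := by simp only [Matrix.mul_assoc]
      _ = _ := by rw [hVV, Matrix.one_mul, Matrix.mul_one]
  have habs : CFC.sqrt ((ρ - σ).conjTranspose * (ρ - σ)) =
      V * Matrix.diagonal (fun j => ((|d j| : ℝ) : ℂ)) * V.conjTranspose := by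
    apply CFC.sqrt_unique
    · rw [hD.eq, hspec]
      have h : ∀ f g : X → ℂ, V * Matrix.diagonal f * V.conjTranspose *
          (V * Matrix.diagonal g * V.conjTranspose) =
          V * Matrix.diagonal (fun j => f j * g j) * V.conjTranspose := by
        intro f g
        calc _ = V * Matrix.diagonal f * (V.conjTranspose * V) * Matrix.diagonal g *
              V.conjTranspose := by simp only [Matrix.mul_assoc]
          _ = _ := by rw [hVV, Matrix.mul_one, Matrix.mul_assoc V, Matrix.diagonal_mul_diagonal]
      rw [h, h]
      congr 3
      funext j
      rw [← Complex.ofReal_mul, ← Complex.ofReal_mul, abs_mul_abs_self]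
    · refine (Matrix.PosSemidef.mul_mul_conjTranspose_same ?_ V).nonneg
      refine Matrix.PosSemidef.diagonal fun j => ?_
      simp
  refine ⟨V.conjTranspose, by rw [Matrix.conjTranspose_conjTranspose, hVV'], ?_⟩
  rw [traceDistance, habs, Matrix.trace_mul_comm, ← Matrix.mul_assoc, hVV, Matrix.one_mul,
    Matrix.trace_diagonal]
  rw [← mul_assoc]
  norm_num
  refine Finset.sum_congr rfl fun j _ => ?_
  have := congrArg Complex.re (congrFun (congrFun hdiag j) j)
  rw [Matrix.diagonal_apply_eq, Complex.ofReal_re, Matrix.mul_sub, Matrix.sub_mul,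
    Matrix.sub_apply, Complex.sub_re] at this
  rw [outcomeProb, outcomeProb, Matrix.conjTranspose_conjTranspose, this]

/-! ### Distinguishing product distributions -/

section Bhattacharyya

variable {X : Type} [Fintype X] {p r : X → ℝ}

/-- Cauchy–Schwarz for `|p - r| = |√p - √r| (√p + √r)`: with `B` the Bhattacharyya coefficient, the
two factors have squared norms `2 - 2B` and `2 + 2B`. -/
theorem sq_sum_sqrt_mul_le (hp : ∀ x, 0 ≤ p x) (hr : ∀ x, 0 ≤ r x) (hp1 : ∑ x, p x = 1)
    (hr1 : ∑ x, r x = 1) :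
    (∑ x, √(p x * r x)) ^ 2 ≤ 1 - (1 / 2 * ∑ x, |p x - r x|) ^ 2 := by
  set B := ∑ x, √(p x * r x) with hB
  have h1 : ∑ x, (√(p x) - √(r x)) ^ 2 = 2 - 2 * B := by
    have : ∀ x, (√(p x) - √(r x)) ^ 2 = p x + r x - 2 * √(p x * r x) := fun x => by
      rw [Real.sqrt_mul (hp x), sub_sq, Real.sq_sqrt (hp x), Real.sq_sqrt (hr x)]; ring
    simp only [this, Finset.sum_sub_distrib, Finset.sum_add_distrib, hp1, hr1, ← Finset.mul_sum]
    norm_num [hB]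
  have h2 : ∑ x, (√(p x) + √(r x)) ^ 2 = 2 + 2 * B := by
    have : ∀ x, (√(p x) + √(r x)) ^ 2 = p x + r x + 2 * √(p x * r x) := fun x => by
      rw [Real.sqrt_mul (hp x), add_sq, Real.sq_sqrt (hp x), Real.sq_sqrt (hr x)]; ring
    simp only [this, Finset.sum_add_distrib, hp1, hr1, ← Finset.mul_sum]
    norm_num [hB]
  have h3 : (∑ x, |√(p x) - √(r x)| * (√(p x) + √(r x))) ^ 2 ≤
      (∑ x, |√(p x) - √(r x)| ^ 2) * ∑ x, (√(p x) + √(r x)) ^ 2 :=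
    Finset.sum_mul_sq_le_sq_mul_sq _ _ _
  have h4 : ∀ x, |√(p x) - √(r x)| * (√(p x) + √(r x)) = |p x - r x| := fun x => by
    have h5 : 0 ≤ √(p x) + √(r x) := by positivity
    rw [← abs_of_nonneg h5, ← abs_mul]
    congr 1
    have := Real.sq_sqrt (hp x)
    have := Real.sq_sqrt (hr x)
    nlinarith
  simp only [h4, sq_abs, h1, h2] at h3
  nlinarith

/-- The minimum is at most the geometric mean, whose sum factors into a power of the Bhattacharyya
coefficient `B`. Finally `B² ≤ 1 - δ² ≤ exp(-δ²)`. -/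
theorem sum_min_prod_le {S : Type} [Fintype S] [DecidableEq S] (hp : ∀ x, 0 ≤ p x)
    (hr : ∀ x, 0 ≤ r x) (hp1 : ∑ x, p x = 1) (hr1 : ∑ x, r x = 1) :
    ∑ y : S → X, min (∏ s, p (y s)) (∏ s, r (y s)) ≤
      Real.exp (-(1 / 2 * ∑ x, |p x - r x|) ^ 2 / 2) ^ Fintype.card S := by
  set δ := 1 / 2 * ∑ x, |p x - r x| with hδ
  have hB : ∑ x, √(p x * r x) ≤ Real.exp (-δ ^ 2 / 2) := by
    apply le_of_sq_le_sq _ (Real.exp_pos _).le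
    rw [← Real.exp_nat_mul]
    calc _ ≤ 1 - δ ^ 2 := sq_sum_sqrt_mul_le hp hr hp1 hr1
      _ ≤ _ := by
        have := Real.add_one_le_exp (-δ ^ 2)
        have e : ((2 : ℕ) : ℝ) * (-δ ^ 2 / 2) = -δ ^ 2 := by push_cast; ring
        rw [e]; linarith
  calc _ ≤ ∑ y : S → X, ∏ s, √(p (y s) * r (y s)) := by
        refine Finset.sum_le_sum fun y _ => ?_
        have h1 : 0 ≤ ∏ s, p (y s) := Finset.prod_nonneg fun s _ => hp _
        have h2 : 0 ≤ ∏ s, r (y s) := Finset.prod_nonneg fun s _ => hr _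
        rw [← Real.sqrt_prod _ (fun s _ => mul_nonneg (hp _) (hr _)), Finset.prod_mul_distrib]
        apply Real.le_sqrt_of_sq_le
        rw [sq]
        exact mul_le_mul (min_le_left _ _) (min_le_right _ _) (le_min h1 h2) h1
    _ = (∑ x, √(p x * r x)) ^ Fintype.card S := by
        rw [sum_prod_pi (fun (_ : S) x => √(p x * r x))]
        simp
    _ ≤ _ := pow_le_pow_left₀ (Finset.sum_nonneg fun _ _ => Real.sqrt_nonneg _) hB _

/-- The maximum likelihood test guesses the right one of two product distributions except with
exponentially small probability. -/
theorem exists_guess {S : Type} [Fintype S] [DecidableEq S] (P : Bool → X → ℝ)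
    (hP : ∀ b x, 0 ≤ P b x) (hP1 : ∀ b, ∑ x, P b x = 1) :
    ∃ g : (S → X) → Bool, 1 - 1 / 2 *
      Real.exp (-(1 / 2 * ∑ x, |P false x - P true x|) ^ 2 / 2) ^ Fintype.card S ≤
      1 / 2 * ∑ b, ∑ y : S → X, if g y = b then ∏ s, P b (y s) else 0 := by
  refine ⟨fun y => decide (∏ s, P false (y s) < ∏ s, P true (y s)), ?_⟩
  have h := sum_min_prod_le (S := S) (hP false) (hP true) (hP1 false) (hP1 true)
  have h1 : ∀ b, ∑ y : S → X, ∏ s, P b (y s) = 1 := fun b => by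
    rw [sum_prod_pi (fun (_ : S) x => P b x)]; simp [hP1]
  -- The test collects the larger of the two likelihoods, that is, their sum minus their minimum.
  have h2 : ∀ y : S → X, (∑ b, if decide (∏ s, P false (y s) < ∏ s, P true (y s)) = b then
      ∏ s, P b (y s) else 0) = ∏ s, P false (y s) + ∏ s, P true (y s) -
      min (∏ s, P false (y s)) (∏ s, P true (y s)) := by
    intro y
    rw [Fintype.sum_bool]
    by_cases hlt : ∏ s, P false (y s) < ∏ s, P true (y s)
    · simp [hlt, min_eq_left hlt.le]
    · simp [hlt, min_eq_right (not_lt.mp hlt)]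
  rw [Finset.sum_comm]
  simp only [h2, Finset.sum_sub_distrib, Finset.sum_add_distrib, h1]
  linarith

end Bhattacharyya

/-! ### Quadratic forms -/

/-- The quadratic form `⟨w, ρ w⟩`. -/
def quadForm {X : Type} [Fintype X] (ρ : Matrix X X ℂ) (w : X → ℂ) : ℂ :=
  ∑ x, ∑ y, star (w x) * ρ x y * w y

section QuadForm

variable {X Y S Z : Type} [Fintype X] [Fintype Y] [Fintype S] [Fintype Z]

theorem quadForm_eq (ρ : Matrix X X ℂ) (w : X → ℂ) :
    quadForm ρ w = star w ⬝ᵥ ρ.mulVec w := by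
  simp only [quadForm, dotProduct, Matrix.mulVec, Finset.mul_sum, mul_assoc, Pi.star_apply]

theorem quadForm_smul (c : ℂ) (ρ : Matrix X X ℂ) (w : X → ℂ) :
    quadForm (c • ρ) w = c * quadForm ρ w := by
  rw [quadForm_eq, quadForm_eq, Matrix.smul_mulVec, dotProduct_smul, smul_eq_mul]

theorem quadForm_sum (ρ : Z → Matrix X X ℂ) (w : X → ℂ) :
    quadForm (∑ z, ρ z) w = ∑ z, quadForm (ρ z) w := by
  simp only [quadForm_eq, Matrix.sum_mulVec, dotProduct_sum]

theorem quadForm_conj (K : Matrix Y X ℂ) (ρ : Matrix X X ℂ) (w : Y → ℂ) :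
    quadForm (K * ρ * K.conjTranspose) w = quadForm ρ (K.conjTranspose.mulVec w) := by
  rw [quadForm_eq, quadForm_eq, Matrix.star_mulVec, Matrix.conjTranspose_conjTranspose,
    ← Matrix.dotProduct_mulVec, Matrix.mulVec_mulVec, Matrix.mulVec_mulVec]

theorem quadForm_reindex (e : X ≃ Y) (ρ : Matrix X X ℂ) (w : Y → ℂ) :
    quadForm (ρ.submatrix e.symm e.symm) w = quadForm ρ fun x => w (e x) := by
  simp only [quadForm, ← e.sum_comp, Matrix.submatrix_apply, e.symm_apply_apply]

theorem quadForm_kronecker (A : Matrix X X ℂ) (B : Matrix Y Y ℂ) (v : X → ℂ) (w : Y → ℂ) :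
    quadForm (A ⊗ₖ B) (fun x => v x.1 * w x.2) = quadForm A v * quadForm B w := by
  simp only [quadForm, Fintype.sum_prod_type, Matrix.kronecker_apply, Finset.sum_mul_sum]
  refine Finset.sum_congr rfl fun x _ => Finset.sum_congr rfl fun x' _ =>
    Finset.sum_congr rfl fun y _ => Finset.sum_congr rfl fun y' _ => ?_
  rw [star_mul']
  ring

theorem quadForm_piMat [DecidableEq S] (M : S → Matrix X X ℂ) (w : S → X → ℂ) :
    quadForm (piMat M) (fun x => ∏ s, w s (x s)) = ∏ s, quadForm (M s) (w s) := by
  have h : ∀ x y : S → X, star (∏ s, w s (x s)) * piMat M x y * ∏ s, w s (y s) =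
      ∏ s, (star (w s (x s)) * M s (x s) (y s) * w s (y s)) := by
    intro x y
    rw [piMat_apply, star_prod, ← Finset.prod_mul_distrib, ← Finset.prod_mul_distrib]
  simp only [quadForm, h]
  rw [← sum_prod_pi fun s a => ∑ y, star (w s a) * M s a y * w s y]
  exact Finset.sum_congr rfl fun x _ =>
    sum_prod_pi fun s b => star (w s (x s)) * M s (x s) b * w s b

theorem quadForm_vecMulVec (v w : X → ℂ) :
    quadForm (Matrix.vecMulVec v (star v)) w = (∑ x, star (w x) * v x) * ∑ x, star (v x) * w x := by
  simp only [quadForm, Matrix.vecMulVec_apply, Finset.sum_mul_sum, Pi.star_apply]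
  exact Finset.sum_congr rfl fun x _ => Finset.sum_congr rfl fun y _ => by ring

end QuadForm

/-! ### Bell states with a phase -/

/-- The vector `(|00⟩ + (-1)^z |11⟩) / √2`. -/
def ebit (z x y : Bool) : ℂ :=
  if x = y then (if z && x then -1 else 1) / (Real.sqrt 2 : ℂ) else 0

/-- The tensor product of the Bell states `(|00⟩ + (-1)^(z j) |11⟩) / √2`. -/
def ebits {q : ℕ} (z : Bits (Fin q)) (v : Bits (Fin q) × Bits (Fin q)) : ℂ :=
  ∏ j, ebit (z j) (v.1 j) (v.2 j)

theorem sqrt_two_mul_self : (Real.sqrt 2 : ℂ) * (Real.sqrt 2 : ℂ) = 2 := by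
  rw [← Complex.ofReal_mul, Real.mul_self_sqrt (by norm_num)]; norm_num

theorem star_ebit (z x y : Bool) : star (ebit z x y) = ebit z x y := by
  unfold ebit
  split_ifs <;> simp

theorem ebit_mul (z z' x y x' y' : Bool) : ebit z x y * ebit z' x' y' =
    if x = y ∧ x' = y' then (if z && x then -1 else 1) * (if z' && x' then -1 else 1) / 2 else 0
        := by
  unfold ebit
  by_cases h : x = y
  · by_cases h' : x' = y'
    · rw [if_pos h, if_pos h', if_pos (And.intro h h'), div_mul_div_comm, sqrt_two_mul_self]
    · simp [h']
  · simp [h]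

theorem sum_ebit_mul (z z' : Bool) :
    ∑ v : Bool × Bool, ebit z v.1 v.2 * ebit z' v.1 v.2 = if z = z' then 1 else 0 := by
  simp only [ebit_mul, Fintype.sum_prod_type, Fintype.sum_bool]
  cases z <;> cases z' <;> norm_num

/-- Summing over the phase cancels the coherences between `|00⟩` and `|11⟩` and leaves the classical
correlation. This is why `ψ` is separable. -/
theorem sum_mul_ebit (x y x' y' : Bool) :
    ∑ z, ebit z x y * ebit z x' y' = if x = y ∧ x' = y' ∧ x = x' then 1 else 0 := by
  simp only [ebit_mul, Fintype.sum_bool]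
  cases x <;> cases y <;> cases x' <;> cases y' <;> norm_num

variable {q : ℕ}

theorem star_ebits (z : Bits (Fin q)) (v : Bits (Fin q) × Bits (Fin q)) :
    star (ebits z v) = ebits z v := by
  simp only [ebits, star_prod, star_ebit]

theorem prod_ite_eq_one_zero {S : Type} [Fintype S] [DecidableEq S] (P : S → Prop)
    [DecidablePred P] [Decidable (∀ s, P s)] :
    (∏ s, if P s then (1 : ℂ) else 0) = if ∀ s, P s then 1 else 0 := by
  rw [Finset.prod_ite_zero]
  simp

theorem sum_ebits_mul (z z' : Bits (Fin q)) :
    ∑ v, ebits z v * ebits z' v = if z = z' then 1 else 0 := by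
  rw [← (Equiv.arrowProdEquivProdArrow (Fin q) (fun _ => Bool) (fun _ => Bool)).sum_comp]
  simp only [ebits, ← Finset.prod_mul_distrib]
  change ∑ v : Fin q → Bool × Bool,
    ∏ j, ebit (z j) (v j).1 (v j).2 * ebit (z' j) (v j).1 (v j).2 = _
  rw [sum_prod_pi fun j (a : Bool × Bool) => ebit (z j) a.1 a.2 * ebit (z' j) a.1 a.2]
  simp only [sum_ebit_mul, prod_ite_eq_one_zero, funext_iff]

theorem sum_mul_ebits (v v' : Bits (Fin q) × Bits (Fin q)) :
    ∑ z, ebits z v * ebits z v' = if v.1 = v.2 ∧ v'.1 = v'.2 ∧ v.1 = v'.1 then 1 else 0 := by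
  simp only [ebits, ← Finset.prod_mul_distrib]
  rw [sum_prod_pi fun j z => ebit z (v.1 j) (v.2 j) * ebit z (v'.1 j) (v'.2 j)]
  simp only [sum_mul_ebit, prod_ite_eq_one_zero, funext_iff, forall_and]

theorem eprPairs_eq : eprPairs q = Matrix.vecMulVec (ebits fun _ => false)
    (star (ebits fun _ : Fin q => false)) := by
  ext x y
  rw [Matrix.vecMulVec_apply, Pi.star_apply, star_ebits]
  simp only [eprPairs, Matrix.of_apply, ebits, ← Finset.prod_mul_distrib, ebit_mul, eprPair]
  simp

/-- The pure state of the vector `ebits z`. -/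
def ebitsState (z : Bits (Fin q)) : DensityMatrix (Bits (Fin q) × Bits (Fin q)) :=
  .pure (ebits z) (by simp only [star_ebits, sum_ebits_mul, if_true])

/-! ### Bell states whose phases are encoded in other states -/

section CodeState

variable {S : Type} {m a : ℕ}

/-- The basis of a register `S × Fin m` and two registers of `q` qubits, the first two of which
are identified with `Fin a`. -/
def bitsEquiv (e : (S × Fin m) ⊕ Fin q ≃ Fin a) :
    (S → Bits (Fin m)) × (Bits (Fin q) × Bits (Fin q)) ≃ Bits (Fin a) × Bits (Fin q) where
  toFun v := (fun i => Sum.elim (fun k => v.1 k.1 k.2) v.2.1 (e.symm i), v.2.2)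
  invFun v := (fun s u => v.1 (e (.inl (s, u))), (fun j => v.1 (e (.inr j)), v.2))
  left_inv v := by simp
  right_inv v := by
    refine Prod.ext (funext fun i => ?_) rfl
    obtain ⟨k, rfl⟩ := e.surjective i
    rcases k with k | k <;> simp

variable [Fintype S] [DecidableEq S]

/-- For uniformly random `z`, the product of the states `ρ (c z s)` held by the first party and
the shared Bell states with phases `z`. -/
def codeState (e : (S × Fin m) ⊕ Fin q ≃ Fin a) (ρ : Bool → DensityMatrix (Bits (Fin m)))
    (c : Bits (Fin q) → S → Bool) : BipartiteState a q :=
  (DensityMatrix.mix fun z =>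
    (DensityMatrix.pi fun s => ρ (c z s)).kron (ebitsState z)).reindex (bitsEquiv e)

/-- Bell states with different phases are orthogonal, so only the term `z = g` of the mixture
survives, with weight `2^{-q}`. Its quadratic form factors over the blocks. -/
theorem quadForm_codeState (e : (S × Fin m) ⊕ Fin q ≃ Fin a)
    (ρ : Bool → DensityMatrix (Bits (Fin m))) (c : Bits (Fin q) → S → Bool)
    (U : Matrix (Bits (Fin m)) (Bits (Fin m)) ℂ) (y : S → Bits (Fin m)) (g : Bits (Fin q)) :
    quadForm (codeState e ρ c).mat (fun v => (∏ s, star (U (y s) (((bitsEquiv e).symm v).1 s))) *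
      ebits g ((bitsEquiv e).symm v).2) =
    ((2 ^ q : ℝ)⁻¹ * ∏ s, outcomeProb U (ρ (c g s)).mat (y s) : ℝ) := by
  simp only [codeState, DensityMatrix.reindex, quadForm_reindex, Equiv.symm_apply_apply,
    DensityMatrix.mix, quadForm_smul, quadForm_sum, DensityMatrix.kron, DensityMatrix.pi,
    ebitsState, DensityMatrix.pure]
  have h1 : ∀ z, quadForm ((piMat fun s => (ρ (c z s)).mat) ⊗ₖ
      Matrix.vecMulVec (ebits z) (star (ebits z)))
      (fun v => (∏ s, star (U (y s) (v.1 s))) * ebits g v.2) =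
      if z = g then ∏ s, (outcomeProb U (ρ (c g s)).mat (y s) : ℂ) else 0 := by
    intro z
    rw [quadForm_kronecker _ _ (fun x : S → Bits (Fin m) => ∏ s, star (U (y s) (x s))) (ebits g),
      quadForm_piMat _ (fun s x => star (U (y s) x)), quadForm_vecMulVec]
    simp only [star_ebits, sum_ebits_mul]
    by_cases hz : z = g
    · subst hz
      simp only [if_true, mul_one]
      refine Finset.prod_congr rfl fun s _ => ?_
      rw [← outcomeProb_ofReal (ρ (c z s)).posSemidef]
      simp only [quadForm, Matrix.mul_apply, Matrix.conjTranspose_apply, star_star, Finset.sum_mul]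
      exact Finset.sum_comm
    · rw [if_neg (Ne.symm hz)]
      simp [hz]
  simp only [h1, Finset.sum_ite_eq', Finset.mem_univ, if_true]
  push_cast
  congr 2
  simp

end CodeState

/-! ### Distillation by measuring the states that encode the phases -/

/-- The party does nothing. -/
def Instrument.id (b : ℕ) : Instrument b b 0 where
  env := 0
  kraus _ _ := 1
  complete := by simp

section Distillation

variable {S : Type} [Fintype S] [DecidableEq S] {q m a : ℕ}

/-- Bit strings as families of blocks. -/
def blocksEquiv (S : Type) [Fintype S] (m : ℕ) :
    Bits (Fin (Fintype.card (S × Fin m))) ≃ (S → Bits (Fin m)) :=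
  (Equiv.arrowCongr (Fintype.equivFin (S × Fin m)).symm (Equiv.refl Bool)).trans
    (Equiv.curry S (Fin m) Bool)

/-- The Kraus operator of the outcome `y` of measuring all blocks in the basis given by `U` and
correcting the phases `g y`. -/
def correctionKraus (e : (S × Fin m) ⊕ Fin q ≃ Fin a) (U : Matrix (Bits (Fin m)) (Bits (Fin m)) ℂ)
    (g : (S → Bits (Fin m)) → Bits (Fin q)) (y : S → Bits (Fin m)) :
    Matrix (Bits (Fin q)) (Bits (Fin a)) ℂ :=
  Matrix.of fun r x => if (fun j => x (e (.inr j))) = r then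
    (∏ j, if g y j && r j then (-1 : ℂ) else 1) * ∏ s, U (y s) (fun u => x (e (.inl (s, u)))) else 0

/-- The correction signs square to one whatever the guess `g y` is, so what remains is the
completeness of the product measurement given by `U`. -/
theorem correctionKraus_complete (e : (S × Fin m) ⊕ Fin q ≃ Fin a)
    {U : Matrix (Bits (Fin m)) (Bits (Fin m)) ℂ} (hU : U.conjTranspose * U = 1)
    (g : (S → Bits (Fin m)) → Bits (Fin q)) :
    ∑ y, (correctionKraus e U g y).conjTranspose * correctionKraus e U g y = 1 := by
  ext x x'
  have hsgn : ∀ y (r : Bits (Fin q)), star (∏ j, if g y j && r j then (-1 : ℂ) else 1) *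
      (∏ j, if g y j && r j then (-1 : ℂ) else 1) = 1 := by
    intro y r
    rw [star_prod, ← Finset.prod_mul_distrib]
    refine Finset.prod_eq_one fun j _ => ?_
    split_ifs <;> simp
  have hpi : ((piMat fun _ : S => U.conjTranspose) * piMat fun _ : S => U)
      (fun s u => x (e (.inl (s, u)))) (fun s u => x' (e (.inl (s, u)))) =
      if (fun s u => x (e (.inl (s, u)))) = (fun (s : S) u => x' (e (.inl (s, u)))) then 1 else 0
          := by
    rw [piMat_mul, hU, piMat_one, Matrix.one_apply]
  simp only [Matrix.mul_apply, piMat_apply, Matrix.conjTranspose_apply] at hpi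
  simp only [Matrix.sum_apply, Matrix.mul_apply, Matrix.conjTranspose_apply, correctionKraus,
    Matrix.of_apply]
  by_cases hr : (fun j => x (e (.inr j))) = fun j => x' (e (.inr j))
  · have h1 : ∀ y, (∑ r, star (if (fun j => x (e (.inr j))) = r then
        (∏ j, if g y j && r j then (-1 : ℂ) else 1) * ∏ s, U (y s) (fun u => x (e (.inl (s, u))))
        else 0) * if (fun j => x' (e (.inr j))) = r then
        (∏ j, if g y j && r j then (-1 : ℂ) else 1) * ∏ s, U (y s) (fun u => x' (e (.inl (s, u))))
        else 0) = (∏ s, star (U (y s) fun u => x (e (.inl (s, u))))) *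
          ∏ s, U (y s) fun u => x' (e (.inl (s, u))) := by
      intro y
      rw [← hr, Finset.sum_eq_single (fun j => x (e (.inr j)))]
      · rw [if_pos rfl, if_pos rfl, star_mul', mul_mul_mul_comm, hsgn, one_mul, star_prod]
      · intro r _ h
        rw [if_neg (Ne.symm h), if_neg (Ne.symm h), mul_zero]
      · simp
    simp only [h1, hpi]
    rw [Matrix.one_apply]
    congr 1
    apply propext
    constructor
    · intro h
      funext i
      obtain ⟨k, rfl⟩ := e.surjective i
      rcases k with k | k
      · exact congrFun (congrFun h k.1) k.2
      · exact congrFun hr k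
    · rintro rfl
      rfl
  · rw [Matrix.one_apply_ne (fun h => hr (by rw [h]))]
    refine Finset.sum_eq_zero fun y _ => Finset.sum_eq_zero fun r _ => ?_
    by_cases h : (fun j => x (e (.inr j))) = r
    · rw [if_neg (c := (fun j => x' (e (.inr j))) = r) (fun h' => hr (h.trans h'.symm)), mul_zero]
    · rw [if_neg h, star_zero, zero_mul]

/-- The measurement and phase correction of `correctionKraus` as an instrument. -/
def correction (e : (S × Fin m) ⊕ Fin q ≃ Fin a) {U : Matrix (Bits (Fin m)) (Bits (Fin m)) ℂ}
    (hU : U.conjTranspose * U = 1) (g : (S → Bits (Fin m)) → Bits (Fin q)) : Instrument a q 0 where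
  -- The outcome is an environment index and no message is produced: the party that measures also
  -- corrects, so the other party need not learn the outcome.
  env := Fintype.card (S × Fin m)
  kraus _ v := correctionKraus e U g (blocksEquiv S m v)
  complete := by
    rw [Fintype.sum_unique, ← correctionKraus_complete e hU g]
    exact (blocksEquiv S m).sum_comp fun y =>
      (correctionKraus e U g y).conjTranspose * correctionKraus e U g y

theorem star_sign_mul_ebit (z x y : Bool) :
    star (if z && x then (-1 : ℂ) else 1) * ebit false x y = ebit z x y := by
  cases z <;> cases x <;> cases y <;> simp [ebit, neg_div]

/-- Pulling the EPR pairs back through the correction gives Bell states with the guessed phases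
times a measurement vector, which is the form that `quadForm_codeState` evaluates. -/
theorem correctionKraus_mulVec_ebits (e : (S × Fin m) ⊕ Fin q ≃ Fin a)
    (U : Matrix (Bits (Fin m)) (Bits (Fin m)) ℂ) (g : (S → Bits (Fin m)) → Bits (Fin q))
    (y : S → Bits (Fin m)) :
    (correctionKraus e U g y ⊗ₖ (1 : Matrix (Bits (Fin q)) (Bits (Fin q)) ℂ)).conjTranspose.mulVec
      (ebits fun _ => false) = fun v => (∏ s, star (U (y s) (((bitsEquiv e).symm v).1 s))) *
      ebits (g y) ((bitsEquiv e).symm v).2 := by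
  funext ⟨x, b⟩
  simp only [Matrix.mulVec, dotProduct, Matrix.conjTranspose_apply, Fintype.sum_prod_type,
    Matrix.kronecker_apply, correctionKraus, Matrix.of_apply]
  rw [Finset.sum_eq_single (fun j => x (e (.inr j))), Finset.sum_eq_single b]
  · rw [if_pos rfl, Matrix.one_apply_eq, mul_one, star_mul', star_prod, star_prod, mul_comm (∏ _,
      _),
      mul_assoc]
    congr 1
    simp only [ebits, ← Finset.prod_mul_distrib]
    refine Finset.prod_congr rfl fun j _ => ?_
    exact star_sign_mul_ebit _ _ _
  · intro r _ h
    rw [Matrix.one_apply_ne h, mul_zero, star_zero, zero_mul]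
  · simp
  · intro r _ h
    refine Finset.sum_eq_zero fun b' _ => ?_
    rw [if_neg (Ne.symm h), zero_mul, star_zero, zero_mul]
  · simp

/-- The one-round protocol in which the first party applies `correction`. -/
def distillProtocol (e : (S × Fin m) ⊕ Fin q ≃ Fin a) {U : Matrix (Bits (Fin m)) (Bits (Fin m)) ℂ}
    (hU : U.conjTranspose * U = 1) (g : (S → Bits (Fin m)) → Bits (Fin q)) : LOCC q q a q :=
  .round (correction e hU g) (.id q) fun _ _ => .done

/-- The target is pure, so the fidelity is a quadratic form, and it splits over the measurement
outcomes. The result is the probability that the guess equals the random `z`: a wrong guess leaves a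
state orthogonal to the EPR pairs. -/
theorem fidelity_distillProtocol (e : (S × Fin m) ⊕ Fin q ≃ Fin a)
    {U : Matrix (Bits (Fin m)) (Bits (Fin m)) ℂ}
    (hU : U.conjTranspose * U = 1) (g : (S → Bits (Fin m)) → Bits (Fin q))
    (ρ : Bool → DensityMatrix (Bits (Fin m))) (c : Bits (Fin q) → S → Bool) :
    fidelity ((distillProtocol e hU g).apply (codeState e ρ c).mat) (eprPairs q) =
      ∑ y, (2 ^ q : ℝ)⁻¹ * ∏ s, outcomeProb U (ρ (c (g y) s)).mat (y s) := by
  have h : (distillProtocol e hU g).apply (codeState e ρ c).mat =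
      ∑ y, (correctionKraus e U g y ⊗ₖ (1 : Matrix (Bits (Fin q)) (Bits (Fin q)) ℂ)) *
        (codeState e ρ c).mat *
        (correctionKraus e U g y ⊗ₖ (1 : Matrix (Bits (Fin q)) (Bits (Fin q)) ℂ)).conjTranspose :=
            by
    rw [← (blocksEquiv S m).sum_comp]
    simp only [distillProtocol, LOCC.apply, Fintype.sum_unique]
    refine Finset.sum_congr rfl fun y _ => ?_
    exact Fintype.sum_unique (fun _ : Bits (Fin 0) => _)
  rw [h, eprPairs_eq, fidelity_pure, ← quadForm_eq, quadForm_sum]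
  · simp only [quadForm_conj, correctionKraus_mulVec_ebits, quadForm_codeState]
    rw [← Complex.ofReal_sum, Complex.ofReal_re]
  · exact Matrix.posSemidef_sum _ fun y _ => (codeState e ρ
      c).posSemidef.mul_mul_conjTranspose_same _

end Distillation

theorem exists_distillation {q t m a : ℕ} (e : ((Fin q × Fin t) × Fin m) ⊕ Fin q ≃ Fin a)
    (ρ : Bool → DensityMatrix (Bits (Fin m))) :
    ∃ Γ : LOCC q q a q,
      1 - q * (1 / 2 * Real.exp (-traceDistance (ρ false).mat (ρ true).mat ^ 2 / 2) ^ t) ≤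
        fidelity (Γ.apply (codeState e ρ fun z s => z s.1).mat) (eprPairs q) := by
  obtain ⟨U, hU, hd⟩ := exists_unitary_traceDistance (ρ false).posSemidef.isHermitian
    (ρ true).posSemidef.isHermitian
  obtain ⟨g, hg⟩ := exists_guess (S := Fin t) (fun b => outcomeProb U (ρ b).mat)
    (fun b => outcomeProb_nonneg (ρ b).posSemidef) (fun b => sum_outcomeProb hU (ρ b))
  simp only [hd, Fintype.card_fin] at hg
  rw [show 1 / 2 * (2 * traceDistance (ρ false).mat (ρ true).mat) =
    traceDistance (ρ false).mat (ρ true).mat by ring] at hg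
  -- Each phase bit is guessed from its own group of `t` blocks.
  refine ⟨distillProtocol e hU fun y j => g fun s => y (j, s), ?_⟩
  rw [fidelity_distillProtocol]
  set η := 1 / 2 * Real.exp (-traceDistance (ρ false).mat (ρ true).mat ^ 2 / 2) ^ t with hη
  have hη1 : η ≤ 1 / 2 := by
    have : Real.exp (-traceDistance (ρ false).mat (ρ true).mat ^ 2 / 2) ^ t ≤ 1 := by
      apply pow_le_one₀ (Real.exp_pos _).le
      apply Real.exp_le_one_iff.mpr
      nlinarith [sq_nonneg (traceDistance (ρ false).mat (ρ true).mat)]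
    linarith
  set Q : Bool → (Fin t → Bits (Fin m)) → ℝ := fun b y =>
    ∏ s, outcomeProb U (ρ b).mat (y s) with hQ
  -- The groups are independent, so the probability that all guesses are right is a `q`-th power.
  have hprod : ∑ y : Fin q × Fin t → Bits (Fin m), (2 ^ q : ℝ)⁻¹ *
      ∏ s, outcomeProb U (ρ (g fun s' => y (s.1, s'))).mat (y s) =
      (1 / 2 * ∑ b, ∑ y : Fin t → Bits (Fin m), if g y = b then Q b y else 0) ^ q := by
    have h1 : ∑ y : Fin q → Fin t → Bits (Fin m), ∏ j, Q (g (y j)) (y j) =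
        (∑ b, ∑ y : Fin t → Bits (Fin m), if g y = b then Q b y else 0) ^ q := by
      rw [sum_prod_pi (fun (_ : Fin q) y => Q (g y) y), Finset.sum_comm]
      simp
    rw [mul_pow, ← h1, ← Finset.mul_sum, one_div, inv_pow,
      ← (Equiv.curry (Fin q) (Fin t) (Bits (Fin m))).sum_comp]
    congr 1
    refine Finset.sum_congr rfl fun y _ => ?_
    rw [Fintype.prod_prod_type]
    rfl
  rw [hprod]
  -- Bernoulli's inequality takes the place of a union bound over the `q` guesses.
  have h2 := one_add_mul_le_pow (a := -η) (by linarith) q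
  calc 1 - q * η = 1 + q * (-η) := by ring
    _ ≤ (1 + -η) ^ q := h2
    _ ≤ _ := pow_le_pow_left₀ (by linarith) (by linarith) q

/-! ### Parallel copies of a circuit -/

theorem piMat_update_apply {S X : Type} [Fintype S] [DecidableEq S] [DecidableEq X] (s : S)
    (M : Matrix X X ℂ) (x y : S → X) :
    piMat (Function.update (fun _ => 1) s M) x y =
      if ∀ s', s' ≠ s → x s' = y s' then M (x s) (y s) else 0 := by
  rw [piMat_apply, ← Finset.mul_prod_erase _ _ (Finset.mem_univ s), Function.update_self]
  split_ifs with h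
  · rw [Finset.prod_eq_one, mul_one]
    intro s' hs'
    have h' := Finset.ne_of_mem_erase hs'
    rw [Function.update_of_ne h', h s' h', Matrix.one_apply_eq]
  · push Not at h
    obtain ⟨s', hs', hx⟩ := h
    rw [Finset.prod_eq_zero (Finset.mem_erase.mpr ⟨hs', Finset.mem_univ s'⟩), mul_zero]
    rw [Function.update_of_ne hs', Matrix.one_apply_ne hx]

/-- A gate on some of the wires of a larger circuit. -/
def Gate.lift {N N' : ℕ} (f : Fin N ↪ Fin N') : Gate N → Gate N'
  | .had w => .had (f w)
  | .tee w => .tee (f w)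
  | .cnot c t h => .cnot (f c) (f t) (f.injective.ne h)

section Parallel

variable {S : Type} [Fintype S] [DecidableEq S] {N N' : ℕ}

/-- The wires of one of several blocks. -/
def blockEmb (w : S × Fin N ≃ Fin N') (s : S) : Fin N ↪ Fin N' :=
  ⟨fun v => w (s, v), fun v v' h => by simpa using h⟩

theorem blockEmb_apply (w : S × Fin N ≃ Fin N') (s : S) (v : Fin N) :
    blockEmb w s v = w (s, v) := rfl

/-- The bits of all blocks together. -/
def joinBits (w : S × Fin N ≃ Fin N') (x : S → Bits (Fin N)) : Bits (Fin N') :=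
  fun v => x (w.symm v).1 (w.symm v).2

/-- `joinBits` as an equivalence. -/
def joinBitsEquiv (w : S × Fin N ≃ Fin N') : (S → Bits (Fin N)) ≃ Bits (Fin N') where
  toFun := joinBits w
  invFun x s v := x (w (s, v))
  left_inv x := by simp [joinBits]
  right_inv x := by funext v; simp [joinBits]

@[simp] theorem joinBits_apply (w : S × Fin N ≃ Fin N') (x : S → Bits (Fin N)) (s : S)
    (v : Fin N) : joinBits w x (w (s, v)) = x s v := by
  simp [joinBits]

theorem forall_ne_blockEmb_iff (w : S × Fin N ≃ Fin N') (s : S) (u : Fin N)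
    (x y : S → Bits (Fin N)) :
    (∀ v, v ≠ blockEmb w s u → joinBits w x v = joinBits w y v) ↔
      (∀ s', s' ≠ s → x s' = y s') ∧ ∀ v, v ≠ u → x s v = y s v := by
  constructor
  · intro h
    refine ⟨fun s' hs' => funext fun v => ?_, fun v hv => ?_⟩
    · have := h (w (s', v)) (fun h' => hs' (congrArg Prod.fst (w.injective h')))
      simpa using this
    · have := h (w (s, v)) (fun h' => hv (congrArg Prod.snd (w.injective h')))
      simpa using this
  · rintro ⟨h1, h2⟩ v hv
    obtain ⟨⟨s', v⟩, rfl⟩ := w.surjective v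
    rw [joinBits_apply, joinBits_apply]
    by_cases hs : s' = s
    · subst hs
      exact h2 v fun h => hv (by rw [h]; rfl)
    · rw [h1 s' hs]

/-- In the product basis, a gate placed on one block is that gate tensored with identities. -/
theorem Gate.lift_mat (w : S × Fin N ≃ Fin N') (s : S) (g : Gate N) :
    (g.lift (blockEmb w s)).mat.submatrix (joinBitsEquiv w) (joinBitsEquiv w) =
      piMat (Function.update (fun _ => 1) s g.mat) := by
  ext x y
  rw [piMat_update_apply, Matrix.submatrix_apply]
  change (g.lift (blockEmb w s)).mat (joinBits w x) (joinBits w y) = _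
  have hval : ∀ (z : S → Bits (Fin N)) (u : Fin N), joinBits w z (blockEmb w s u) = z s u :=
    fun z u => joinBits_apply w z s u
  cases g with
  | had u =>
    simp only [Gate.lift, Gate.mat, Matrix.of_apply, forall_ne_blockEmb_iff, hval, ite_and]
  | tee u =>
    simp only [Gate.lift, Gate.mat, Matrix.diagonal_apply, hval]
    rw [← ite_and]
    congr 1
    apply propext
    constructor
    · intro h
      have h := (joinBitsEquiv w).injective h
      subst h
      exact ⟨fun _ _ => rfl, rfl⟩
    · rintro ⟨h1, h2⟩
      congr 1
      funext s'
      by_cases hs : s' = s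
      · rw [hs, h2]
      · exact h1 s' hs
  | cnot c t h =>
    simp only [Gate.lift, Gate.mat, Matrix.of_apply, hval]
    rw [← ite_and]
    congr 1
    apply propext
    constructor
    · intro h
      have h' : ∀ s' v, x s' v = if s' = s ∧ v = t then xor (y s t) (y s c) else y s' v := by
        intro s' v
        have := congrFun h (w (s', v))
        rw [joinBits_apply, Function.update_apply, joinBits_apply] at this
        rw [this]
        congr 1
        apply propext
        rw [blockEmb_apply, w.injective.eq_iff, Prod.mk.injEq]
      refine ⟨fun s' hs => funext fun v => ?_, funext fun v => ?_⟩
      · rw [h', if_neg (fun h => hs h.1)]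
      · rw [h', Function.update_apply]
        simp
    · rintro ⟨h1, h2⟩
      funext v
      obtain ⟨⟨s', v⟩, rfl⟩ := w.surjective v
      rw [joinBits_apply, Function.update_apply, joinBits_apply]
      simp only [blockEmb_apply, w.injective.eq_iff, Prod.mk.injEq]
      by_cases hs : s' = s
      · subst hs
        rw [h2, Function.update_apply]
        simp
      · rw [if_neg (fun h => hs h.1), h1 s' hs]

theorem gatesMat_append (l₁ l₂ : List (Gate N)) :
    gatesMat (l₁ ++ l₂) = gatesMat l₂ * gatesMat l₁ := by
  induction l₁ with
  | nil => simp [gatesMat]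
  | cons g l ih => rw [List.cons_append, gatesMat, ih, gatesMat, Matrix.mul_assoc]

theorem gatesMat_map_lift (w : S × Fin N ≃ Fin N') (s : S) (gs : List (Gate N)) :
    (gatesMat (gs.map (Gate.lift (blockEmb w s)))).submatrix (joinBitsEquiv w) (joinBitsEquiv w) =
      piMat (Function.update (fun _ => 1) s (gatesMat gs)) := by
  induction gs with
  | nil =>
    rw [List.map_nil, gatesMat, gatesMat, Function.update_eq_self s (fun _ : S => _), piMat_one,
      Matrix.submatrix_one_equiv]
  | cons g gs ih =>
    rw [List.map_cons, gatesMat, gatesMat, ← Matrix.submatrix_mul_equiv _ _ _ (joinBitsEquiv w), ih,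
      Gate.lift_mat, piMat_mul]
    congr 1
    funext s'
    by_cases hs : s' = s
    · subst hs; simp
    · simp [hs]

/-- The blocks are processed one after the other; `Nodup` ensures that none is processed twice. -/
theorem gatesMat_flatMap_lift (w : S × Fin N ≃ Fin N') (gs : List (Gate N)) (l : List S)
    (hl : l.Nodup) :
    (gatesMat (l.flatMap fun s => gs.map (Gate.lift (blockEmb w s)))).submatrix
      (joinBitsEquiv w) (joinBitsEquiv w) = piMat fun s => if s ∈ l then gatesMat gs else 1 := by
  induction l with
  | nil => simp [gatesMat, piMat_one]
  | cons s l ih =>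
    rw [List.nodup_cons] at hl
    rw [List.flatMap_cons, gatesMat_append, ← Matrix.submatrix_mul_equiv _ _ _ (joinBitsEquiv w),
      ih hl.2, gatesMat_map_lift, piMat_mul]
    congr 1
    funext s'
    by_cases hs : s' = s
    · subst hs; simp [hl.1]
    · simp [hs]

end Parallel

/-! ### State preparation -/

namespace GenCircuit

variable {ι ο : Type}

/-- The amplitude of the outputs `u` and `t` if all wires start in `|0⟩`. -/
def amplitude (C : GenCircuit ι ο) (u : Bits ο) (t : Bits (Fin C.traced)) : ℂ :=
  gatesMat C.gates (fun w => Sum.elim u t (C.out.symm w)) fun _ => false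

/-- The state that a circuit prepares if all wires start in `|0⟩`. -/
def prepared (C : GenCircuit ι ο) : Matrix (Bits ο) (Bits ο) ℂ :=
  Matrix.of fun u u' => ∑ t, C.amplitude u t * star (C.amplitude u' t)

/-- An input wire fed with `|0⟩` behaves like a zero-initialized wire. Hence the generator on the
bit `0` becomes a circuit without inputs, which can be replicated. -/
theorem run_basisState_false [Fintype ι] [DecidableEq ι] (C : GenCircuit ι ο) :
    C.run (basisState fun _ => false) = C.prepared := by
  ext u u'
  simp only [run, Matrix.sum_apply, prepared, Matrix.of_apply]
  refine Finset.sum_congr rfl fun t _ => ?_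
  have h : ∀ v, C.kraus t v (fun _ => false) = C.amplitude v t := by
    intro v
    simp only [kraus, amplitude, Matrix.submatrix_apply]
    congr 1
    funext w
    rcases C.inp.symm w with i | i <;> rfl
  simp [Matrix.mul_apply, basisState, Matrix.single_apply, h, Finset.sum_ite_eq, ite_and]

/-- The outputs and the traced out wires of parallel copies of a circuit. -/
def replicateOut {S ο' : Type} [Fintype S] (C : GenCircuit ι ο) (o : ο' ≃ S × ο) :
    ο' ⊕ Fin (Fintype.card (S × Fin C.traced)) ≃ Fin (Fintype.card (S × Fin C.wires)) :=
  ((Equiv.sumCongr o (Fintype.equivFin (S × Fin C.traced)).symm).trans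
    (Equiv.prodSumDistrib S ο (Fin C.traced)).symm).trans
    ((Equiv.prodCongr (Equiv.refl S) C.out).trans (Fintype.equivFin (S × Fin C.wires)))

theorem replicateOut_symm_apply {S ο' : Type} [Fintype S] (C : GenCircuit ι ο) (o : ο' ≃ S × ο)
    (s : S) (k : ο ⊕ Fin C.traced) :
    (replicateOut C o).symm (Fintype.equivFin (S × Fin C.wires) (s, C.out k)) =
      Sum.map o.symm (Fintype.equivFin (S × Fin C.traced))
        (Equiv.prodSumDistrib S ο (Fin C.traced) (s, k)) := by
  rw [Equiv.symm_apply_eq]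
  rcases k with k | k <;> simp [replicateOut]

/-- Parallel copies of a circuit all of whose wires start in `|0⟩`. -/
def replicate {S ι' ο' : Type} [Fintype S] [DecidableEq S] [IsEmpty ι'] (C : GenCircuit ι ο)
    (o : ο' ≃ S × ο) : GenCircuit ι' ο' where
  wires := Fintype.card (S × Fin C.wires)
  zeros := Fintype.card (S × Fin C.wires)
  traced := Fintype.card (S × Fin C.traced)
  inp := Equiv.emptySum ι' _
  out := replicateOut C o
  gates := Finset.univ.toList.flatMap fun s =>
    C.gates.map (Gate.lift (blockEmb (Fintype.equivFin (S × Fin C.wires)) s))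

section Replicate

variable {S ι' ο' : Type} [Fintype S] [DecidableEq S] [IsEmpty ι']

theorem size_replicate (C : GenCircuit ι ο) (o : ο' ≃ S × ο) :
    (C.replicate o : GenCircuit ι' ο').size = Fintype.card S * C.size := by
  simp only [size, replicate, List.length_flatMap, List.length_map, List.map_const',
    List.sum_replicate, Finset.length_toList, Fintype.card_prod, Fintype.card_fin, smul_eq_mul,
    Finset.card_univ, mul_add]

theorem amplitude_replicate (C : GenCircuit ι ο) (o : ο' ≃ S × ο) (u : Bits ο')
    (t : S → Bits (Fin C.traced)) :
    (C.replicate o : GenCircuit ι' ο').amplitude u (joinBits (Fintype.equivFin _) t) =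
      ∏ s, C.amplitude (fun k => u (o.symm (s, k))) (t s) := by
  have h := gatesMat_flatMap_lift (Fintype.equivFin (S × Fin C.wires)) C.gates
    Finset.univ.toList (Finset.nodup_toList _)
  simp only [Finset.mem_toList, Finset.mem_univ, if_true] at h
  have h2 := congrFun (congrFun h fun s v => Sum.elim (fun k => u (o.symm (s, k))) (t s)
    (C.out.symm v)) fun _ _ => false
  rw [piMat_apply] at h2
  have key : ∀ w : Fin (Fintype.card (S × Fin C.wires)),
      Sum.elim u (joinBits (Fintype.equivFin (S × Fin C.traced)) t)
        ((replicateOut C o).symm w) =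
      joinBits (Fintype.equivFin (S × Fin C.wires))
        (fun s v => Sum.elim (fun k => u (o.symm (s, k))) (t s) (C.out.symm v)) w := by
    intro w
    obtain ⟨⟨s, v⟩, rfl⟩ := (Fintype.equivFin (S × Fin C.wires)).surjective w
    obtain ⟨k, rfl⟩ := C.out.surjective v
    rw [joinBits_apply]
    rw [replicateOut_symm_apply]
    rcases k with k | k <;> simp
  exact (congrArg (fun f => gatesMat (C.replicate o : GenCircuit ι' ο').gates f fun _ => false)
    (funext key)).trans h2

theorem prepared_replicate (C : GenCircuit ι ο) (o : ο' ≃ S × ο) (u u' : Bits ο') :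
    (C.replicate o : GenCircuit ι' ο').prepared u u' =
      ∏ s, C.prepared (fun k => u (o.symm (s, k))) (fun k => u' (o.symm (s, k))) := by
  refine ((joinBitsEquiv (Fintype.equivFin (S × Fin C.traced))).sum_comp fun t =>
    amplitude (C.replicate o : GenCircuit ι' ο') u t *
      star (amplitude (C.replicate o : GenCircuit ι' ο') u' t)).symm.trans ?_
  change ∑ t, amplitude _ u (joinBits _ t) * star (amplitude _ u' (joinBits _ t)) = _
  simp only [amplitude_replicate, star_prod, ← Finset.prod_mul_distrib]
  simp only [prepared]
  exact sum_prod_pi fun s t => C.amplitude (fun k => u (o.symm (s, k))) t *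
    star (C.amplitude (fun k => u' (o.symm (s, k))) t)

end Replicate

/-- The circuit that prepares an EPR pair. -/
def bell : GenCircuit (Fin 0) (Fin 1 ⊕ Fin 1) where
  wires := 2
  zeros := 2
  traced := 0
  inp := Equiv.emptySum _ _
  out := (Equiv.sumEmpty _ _).trans finSumFinEquiv
  gates := [.had 0, .cnot 0 1 (by decide)]

theorem prepared_bell (u u' : Bits (Fin 1 ⊕ Fin 1)) :
    bell.prepared u u' = if u (.inl 0) = u (.inr 0) ∧ u' (.inl 0) = u' (.inr 0) then 1 / 2 else 0
        := by
  have h : ∀ v t, bell.amplitude v t = ebit false (v (.inl 0)) (v (.inr 0)) := by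
    intro v t
    have h0 : ∀ y : Bits (Fin 2), (Gate.had 0).mat y (fun _ => false) =
        if y 1 = false then 1 / (Real.sqrt 2 : ℂ) else 0 := by
      intro y
      simp only [Gate.mat, Matrix.of_apply]
      simp [Fin.forall_fin_two]
    have hx : (fun w : Fin 2 => Sum.elim v t (bell.out.symm w)) = ![v (.inl 0), v (.inr 0)] := by
      funext w
      fin_cases w <;> rfl
    simp only [amplitude]
    change gatesMat [Gate.had 0, Gate.cnot 0 1 (by decide)]
      (fun w : Fin 2 => Sum.elim v t (bell.out.symm w)) (fun _ => false) = _
    rw [hx, gatesMat, gatesMat, gatesMat, Matrix.one_mul, Matrix.mul_apply]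
    simp only [h0]
    simp only [Gate.mat, Matrix.of_apply]
    -- After the Hadamard gate the second qubit is still `0`, and CNOT does not change the first
    -- one, so only one intermediate basis state contributes.
    rw [Finset.sum_eq_single ![v (.inl 0), false]]
    · have : (Function.update ![v (.inl 0), false] 1
          (xor (![v (.inl 0), false] 1) (![v (.inl 0), false] 0)) : Fin 2 → Bool) =
          ![v (.inl 0), v (.inl 0)] := by
        funext w
        fin_cases w <;> simp
      rw [this]
      simp only [ebit]
      cases v (.inl 0) <;> cases v (.inr 0) <;> simp
    · intro y _ hy
      by_cases h1 : y 1 = false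
      · rw [if_neg, zero_mul]
        intro h2
        apply hy
        funext w
        have := congrFun h2 0
        fin_cases w
        · simpa using this.symm
        · simpa using h1
      · rw [if_neg h1, mul_zero]
    · simp
  simp only [prepared, Matrix.of_apply, h, star_ebit, ebit_mul]
  rw [Finset.sum_const, Finset.card_univ, show Fintype.card (Bits (Fin bell.traced)) = 1 from rfl,
    one_smul]
  simp

/-! ### Circuits without gates -/

/-- The circuit without gates that relabels its input wires and traces some of them out. -/
def wiring [Fintype ι] {d : ℕ} (h : ι ≃ ο ⊕ Fin d) : GenCircuit ι ο where
  wires := Fintype.card ι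
  zeros := 0
  traced := d
  inp := (Equiv.sumEmpty _ _).trans (Fintype.equivFin ι)
  out := h.symm.trans (Fintype.equivFin ι)
  gates := []

theorem kraus_wiring [Fintype ι] [DecidableEq ι] {d : ℕ} (h : ι ≃ ο ⊕ Fin d) (t : Bits (Fin d))
    (u : Bits ο) (z : Bits ι) :
    (wiring h).kraus t u z = if z = (fun i => Sum.elim u t (h i)) then 1 else 0 := by
  simp only [kraus, wiring, gatesMat, Matrix.submatrix_apply, Matrix.one_apply]
  congr 1
  apply propext
  constructor
  · intro hz
    funext i
    have : Sum.elim u t (h ((Fintype.equivFin ι).symm (Fintype.equivFin ι i))) =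
      z ((Fintype.equivFin ι).symm (Fintype.equivFin ι i)) := congrFun hz (Fintype.equivFin ι i)
    simpa using this.symm
  · rintro rfl
    rfl

theorem size_wiring [Fintype ι] {d : ℕ} (h : ι ≃ ο ⊕ Fin d) :
    (wiring h).size = Fintype.card ι := by
  simp [wiring, size]

end GenCircuit

/-! ### Preparation of a separable state by circuits with classical communication -/

theorem GenCircuit.kraus_eq_amplitude {ι ο : Type} [IsEmpty ι] (C : GenCircuit ι ο)
    (t : Bits (Fin C.traced)) (u : Bits ο) (z : Bits ι) : C.kraus t u z = C.amplitude u t := by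
  simp only [GenCircuit.kraus, GenCircuit.amplitude, Matrix.submatrix_apply]
  congr 1
  funext w
  rcases C.inp.symm w with i | i
  · exact isEmptyElim i
  · rfl

/-- The joint state after both parties have prepared states without any input. -/
theorem sum_instrument_conj_apply {κ : Type} [Fintype κ] [DecidableEq κ] [IsEmpty κ]
    {a b x y : ℕ} (CA : GenCircuit (Fin 0 ⊕ κ) (Fin a ⊕ Fin x))
    (CB : GenCircuit (Fin 0 ⊕ κ) (Fin b ⊕ Fin y)) (s : Bits κ) (u : Bits (Fin x))
    (v : Bits (Fin y)) (r r' : Bits (Fin a) × Bits (Fin b)) :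
    (∑ e, ∑ f, ((CA.instrument s).kraus u e ⊗ₖ (CB.instrument s).kraus v f) * eprPairs 0 *
      ((CA.instrument s).kraus u e ⊗ₖ (CB.instrument s).kraus v f).conjTranspose) r r' =
    CA.prepared (Sum.elim r.1 u) (Sum.elim r'.1 u) *
      CB.prepared (Sum.elim r.2 v) (Sum.elim r'.2 v) := by
  -- Zero EPR pairs form the `1 × 1` identity.
  have h1 : ∀ z z', eprPairs 0 z z' = 1 := fun z z' => by simp [eprPairs]
  have h2 : ∀ (e : Bits (Fin CA.traced)) (f : Bits (Fin CB.traced)) y z,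
      ((CA.instrument s).kraus u e ⊗ₖ (CB.instrument s).kraus v f) y z =
      CA.amplitude (Sum.elim y.1 u) e * CB.amplitude (Sum.elim y.2 v) f := fun e f y z =>
    congrArg₂ (· * ·) (CA.kraus_eq_amplitude e (Sum.elim y.1 u) (Sum.elim z.1 s))
      (CB.kraus_eq_amplitude f (Sum.elim y.2 v) (Sum.elim z.2 s))
  rw [GenCircuit.prepared, GenCircuit.prepared, Matrix.of_apply, Matrix.of_apply,
    Finset.sum_mul_sum, Matrix.sum_apply]
  refine Finset.sum_congr rfl fun (e : Bits (Fin CA.traced)) _ => ?_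
  rw [Matrix.sum_apply]
  refine Finset.sum_congr rfl fun (f : Bits (Fin CB.traced)) _ => ?_
  simp only [Matrix.mul_apply, Fintype.sum_prod_type, Fintype.sum_unique, h1,
    Matrix.conjTranspose_apply]
  rw [h2, h2, star_mul']
  ring

/-- Conjugation by a matrix with at most one entry in each row. -/
theorem conj_apply_of_row {X Y : Type} [Fintype X] [DecidableEq X] (K : Matrix Y X ℂ)
    (ρ : Matrix X X ℂ) (c : Y → ℂ) (f : Y → X) (hK : ∀ y x, K y x = if x = f y then c y else 0)
    (y y' : Y) : (K * ρ * K.conjTranspose) y y' = c y * ρ (f y) (f y') * star (c y') := by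
  simp only [Matrix.mul_apply, Matrix.conjTranspose_apply, hK, ite_mul, zero_mul,
    Finset.sum_ite_eq', Finset.mem_univ, if_true]
  rw [Finset.sum_eq_single (f y')]
  · simp
  · intro x _ hx
    rw [if_neg hx, star_zero, mul_zero]
  · simp

section PrepProtocol

variable {S ι : Type} [Fintype S] [DecidableEq S] {q m a : ℕ}

/-- One half of each EPR pair is kept, the other half is sent. -/
def bellOutputs (q : ℕ) : Fin q ⊕ Fin q ≃ Fin q × (Fin 1 ⊕ Fin 1) :=
  (Equiv.sumCongr (Equiv.prodUnique (Fin q) (Fin 1)).symm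
    (Equiv.prodUnique (Fin q) (Fin 1)).symm).trans (Equiv.prodSumDistrib _ _ _).symm

/-- The first party takes over the bits of the message. -/
def appendMessage (e : (S × Fin m) ⊕ Fin q ≃ Fin a) :
    Fin (Fintype.card (S × Fin m)) ⊕ (Fin 0 ⊕ Fin q) ≃ (Fin a ⊕ Fin 0) ⊕ Fin 0 :=
  ((Equiv.sumCongr (Fintype.equivFin (S × Fin m)).symm (Equiv.emptySum _ _)).trans e).trans
    ((Equiv.sumEmpty _ _).symm.trans (Equiv.sumEmpty _ _).symm)

/-- The second party drops the message. -/
def dropMessage (q : ℕ) : Fin q ⊕ (Fin 0 ⊕ Fin q) ≃ (Fin q ⊕ Fin 0) ⊕ Fin q :=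
  Equiv.sumCongr (Equiv.sumEmpty _ _).symm (Equiv.emptySum _ _)

/-- The second party tosses coins and tells the first party the results, to which the first party
appends copies of the state prepared by `C`. -/
def prepProtocol (e : (S × Fin m) ⊕ Fin q ≃ Fin a) (C : GenCircuit ι (Fin m)) :
    CircuitLOCC a q 0 0 0 0 :=
  .round (a₁ := Fintype.card (S × Fin m)) (b₁ := q) (x₁ := 0) (y₁ := q)
    (C.replicate ((Equiv.sumEmpty _ _).trans (Fintype.equivFin (S × Fin m)).symm))
    -- A coin toss is the measured half of a locally prepared EPR pair; the kept half becomes a copy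
    -- of the result.
    (GenCircuit.bell.replicate (bellOutputs q))
    (.round (a₁ := a) (b₁ := q) (x₁ := 0) (y₁ := 0) (GenCircuit.wiring (appendMessage e))
      (GenCircuit.wiring (dropMessage q)) .done)

/-- Of the `7 q`, the two gates and two wires of each Bell circuit contribute `4 q`, the message
wires read by `A` contribute `q`, and the kept and dropped wires of `B` contribute `2 q`. The final
`2` counts the rounds. -/
theorem size_prepProtocol (e : (S × Fin m) ⊕ Fin q ≃ Fin a) (C : GenCircuit ι (Fin m)) :
    (prepProtocol e C).size = Fintype.card S * C.size + Fintype.card S * m + 7 * q + 2 := by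
  simp only [prepProtocol, CircuitLOCC.size, GenCircuit.size_replicate, GenCircuit.size_wiring,
    Fintype.card_sum, Fintype.card_prod, Fintype.card_fin]
  simp only [GenCircuit.size, GenCircuit.bell, List.length_cons, List.length_nil]
  ring

theorem kraus_appendMessage (e : (S × Fin m) ⊕ Fin q ≃ Fin a) (u₀ : Bits (Fin 0))
    (v : Bits (Fin q)) (u t : Bits (Fin 0)) (r : Bits (Fin a))
    (x : Bits (Fin (Fintype.card (S × Fin m)))) :
    (((GenCircuit.wiring (appendMessage e)).instrument (Sum.elim u₀ v)).kraus u t) r x =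
      if x = fun k => r (e (.inl ((Fintype.equivFin (S × Fin m)).symm k))) then
        (if v = fun j => r (e (.inr j)) then 1 else 0) else 0 := by
  refine (GenCircuit.kraus_wiring _ _ _ _).trans ?_
  rw [← ite_and]
  congr 1
  apply propext
  constructor
  · intro h
    exact ⟨funext fun k => congrFun h (.inl k), funext fun j => congrFun h (.inr (.inr j))⟩
  · rintro ⟨rfl, rfl⟩
    funext i
    rcases i with i | i | i
    · rfl
    · exact i.elim0
    · rfl

theorem kraus_dropMessage (u₀ : Bits (Fin 0)) (v : Bits (Fin q)) (u : Bits (Fin 0))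
    (t r x : Bits (Fin q)) :
    (((GenCircuit.wiring (dropMessage q)).instrument (Sum.elim u₀ v)).kraus u t) r x =
      if x = r then (if v = t then 1 else 0) else 0 := by
  refine (GenCircuit.kraus_wiring _ _ _ _).trans ?_
  rw [← ite_and]
  congr 1
  apply propext
  constructor
  · intro h
    exact ⟨funext fun k => congrFun h (.inl k), funext fun j => congrFun h (.inr (.inr j))⟩
  · rintro ⟨rfl, rfl⟩
    funext i
    rcases i with i | i | i
    · rfl
    · exact i.elim0
    · rfl

theorem prepProtocol_apply (e : (S × Fin m) ⊕ Fin q ≃ Fin a) (C : GenCircuit ι (Fin m))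
    (x x' : Bits (Fin a)) (b b' : Bits (Fin q)) :
    (prepProtocol e C).apply (eprPairs 0) (x, b) (x', b') =
      (∏ s, C.prepared (fun i => x (e (.inl (s, i)))) (fun i => x' (e (.inl (s, i))))) *
        if (fun j => x (e (.inr j))) = b ∧ (fun j => x' (e (.inr j))) = b' ∧
          (fun j => x (e (.inr j))) = fun j => x' (e (.inr j)) then (2 ^ q : ℂ)⁻¹ else 0 := by
  -- The second round forces the last `q` bits of `A` to equal the message `v`, and the dropped copy
  -- of `v` leaves a single Kraus term.
  have hround : ∀ (v : Bits (Fin q)) (σ : Matrix (Bits (Fin (Fintype.card (S × Fin m))) ×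
      Bits (Fin q)) (Bits (Fin (Fintype.card (S × Fin m))) × Bits (Fin q)) ℂ) (u₀ u u' : Bits (Fin
          0)),
      (∑ t, ∑ t', (((GenCircuit.wiring (appendMessage e)).instrument (Sum.elim u₀ v)).kraus u t ⊗ₖ
        ((GenCircuit.wiring (dropMessage q)).instrument (Sum.elim u₀ v)).kraus u' t') * σ *
        (((GenCircuit.wiring (appendMessage e)).instrument (Sum.elim u₀ v)).kraus u t ⊗ₖ
        ((GenCircuit.wiring (dropMessage q)).instrument (Sum.elim u₀ v)).kraus u' t').conjTranspose)
        (x, b) (x', b') =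
      (if v = fun j => x (e (.inr j)) then 1 else 0) * (if v = fun j => x' (e (.inr j)) then 1
          else 0) *
      σ (fun k => x (e (.inl ((Fintype.equivFin (S × Fin m)).symm k))), b)
        (fun k => x' (e (.inl ((Fintype.equivFin (S × Fin m)).symm k))), b') := by
    intro v σ u₀ u u'
    have h1 : ∀ (t : Bits (Fin 0)) (t' : Bits (Fin q)),
        ((((GenCircuit.wiring (appendMessage e)).instrument (Sum.elim u₀ v)).kraus u t ⊗ₖ
        ((GenCircuit.wiring (dropMessage q)).instrument (Sum.elim u₀ v)).kraus u' t') * σ *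
        (((GenCircuit.wiring (appendMessage e)).instrument (Sum.elim u₀ v)).kraus u t ⊗ₖ
        ((GenCircuit.wiring (dropMessage q)).instrument (Sum.elim u₀ v)).kraus u' t').conjTranspose)
        (x, b) (x', b') = if v = t' then
        (if v = fun j => x (e (.inr j)) then 1 else 0) * (if v = fun j => x' (e (.inr j)) then 1
            else 0) *
          σ (fun k => x (e (.inl ((Fintype.equivFin (S × Fin m)).symm k))), b)
            (fun k => x' (e (.inl ((Fintype.equivFin (S × Fin m)).symm k))), b') else 0 := by
      intro t t'
      rw [conj_apply_of_row _ σ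
        (fun y => (if v = fun j => y.1 (e (.inr j)) then 1 else 0) * if v = t' then 1 else 0)
        (fun y => (fun k => y.1 (e (.inl ((Fintype.equivFin (S × Fin m)).symm k))), y.2))]
      · by_cases h : v = t'
        · simp only [if_pos h, mul_one]
          split_ifs <;> simp
        · simp [h]
      · rintro ⟨y, c⟩ ⟨z, d⟩
        rw [Matrix.kronecker_apply, kraus_appendMessage, kraus_dropMessage]
        simp only [Prod.mk.injEq]
        by_cases h3 : d = c
        · simp only [h3, and_true, if_true, ite_mul, zero_mul]
        · simp only [h3, and_false, if_false, mul_zero]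
    rw [Matrix.sum_apply]
    refine (Fintype.sum_unique (fun _ : Bits (Fin 0) => _)).trans ?_
    rw [Matrix.sum_apply]
    exact (Finset.sum_congr rfl fun t' _ => h1 _ t').trans
      ((Finset.sum_ite_eq (Finset.univ : Finset (Bits (Fin q))) v fun _ => _).trans
        (if_pos (Finset.mem_univ _)))
  have hbell : ∀ v : Bits (Fin q), (GenCircuit.bell.replicate (bellOutputs q) :
      GenCircuit (Fin 0 ⊕ (Fin 0 ⊕ Fin 0)) _).prepared (Sum.elim b v) (Sum.elim b' v) =
      if b = v ∧ b' = v then (2 ^ q : ℂ)⁻¹ else 0 := by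
    intro v
    have h1 : ∀ s, GenCircuit.bell.prepared
        (fun k => Sum.elim b v ((bellOutputs q).symm (s, k)))
        (fun k => Sum.elim b' v ((bellOutputs q).symm (s, k))) =
        if b s = v s ∧ b' s = v s then (2 : ℂ)⁻¹ else 0 := by
      intro s
      rw [GenCircuit.prepared_bell, one_div]
      rfl
    rw [GenCircuit.prepared_replicate]
    simp only [h1]
    rw [Finset.prod_ite_zero]
    simp [funext_iff, forall_and]
  have hcopies : ∀ u : Bits (Fin 0), (C.replicate ((Equiv.sumEmpty _ _).trans
      (Fintype.equivFin (S × Fin m)).symm) : GenCircuit (Fin 0 ⊕ (Fin 0 ⊕ Fin 0)) _).prepared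
      (Sum.elim (fun k => x (e (.inl ((Fintype.equivFin (S × Fin m)).symm k)))) u)
      (Sum.elim (fun k => x' (e (.inl ((Fintype.equivFin (S × Fin m)).symm k)))) u) =
      ∏ s, C.prepared (fun i => x (e (.inl (s, i)))) (fun i => x' (e (.inl (s, i)))) := by
    intro u
    rw [GenCircuit.prepared_replicate]
    refine Finset.prod_congr rfl fun s _ => congrArg₂ C.prepared (funext fun i => ?_)
      (funext fun i => ?_) <;> simp
  simp only [CircuitLOCC.apply, prepProtocol, CircuitLOCC.toLOCC, LOCC.apply, Fintype.sum_unique]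
  rw [Matrix.sum_apply]
  simp only [hround, sum_instrument_conj_apply]
  simp only [hbell, hcopies]
  generalize (∏ s, C.prepared (fun i => x (e (.inl (s, i)))) (fun i => x' (e (.inl (s, i))))) = A
  generalize (fun j => x (e (.inr j))) = r
  generalize (fun j => x' (e (.inr j))) = r'
  -- Only the message that agrees with the row index contributes; the column index must then agree
  -- with it as well, which makes the shared bits classical.
  rw [Finset.sum_eq_single r]
  · rw [if_pos rfl, one_mul]
    by_cases hr : r = r'
    · subst hr
      rw [if_pos rfl, one_mul]
      simp only [and_true, eq_comm]
    · simp [hr]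
  · intro v _ hv
    rw [if_neg hv, zero_mul, zero_mul]
  · simp

end PrepProtocol

theorem codeState_apply {S : Type} [Fintype S] [DecidableEq S] {q m a : ℕ}
    (e : (S × Fin m) ⊕ Fin q ≃ Fin a) (ρ : Bool → DensityMatrix (Bits (Fin m)))
    (c : Bits (Fin q) → S → Bool) (x x' : Bits (Fin a)) (b b' : Bits (Fin q)) :
    (codeState e ρ c).mat (x, b) (x', b') = (2 ^ q : ℂ)⁻¹ * ∑ z,
      (∏ s, (ρ (c z s)).mat (fun i => x (e (.inl (s, i)))) fun i => x' (e (.inl (s, i)))) *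
        (ebits z (fun j => x (e (.inr j)), b) * ebits z (fun j => x' (e (.inr j)), b')) := by
  have h : ∀ z, ((piMat fun s => (ρ (c z s)).mat) ⊗ₖ Matrix.vecMulVec (ebits z) (star (ebits z)))
      ((bitsEquiv e).symm (x, b)) ((bitsEquiv e).symm (x', b')) =
      (∏ s, (ρ (c z s)).mat (fun i => x (e (.inl (s, i)))) fun i => x' (e (.inl (s, i)))) *
        (ebits z (fun j => x (e (.inr j)), b) * ebits z (fun j => x' (e (.inr j)), b')) := by
    intro z
    rw [Matrix.kronecker_apply, piMat_apply, Matrix.vecMulVec_apply, Pi.star_apply, star_ebits]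
    rfl
  simp only [codeState, DensityMatrix.reindex, Matrix.submatrix_apply, DensityMatrix.mix,
    Matrix.smul_apply, Matrix.sum_apply, DensityMatrix.kron,
    DensityMatrix.pi, ebitsState, DensityMatrix.pure, smul_eq_mul, h]
  congr 1
  simp

/-- For a constant code the blocks do not depend on `z`, so they factor out of the mixture and
`sum_mul_ebits` turns the rest into shared coins. -/
theorem prepProtocol_apply_eq {S ι : Type} [Fintype S] [DecidableEq S] {q m a : ℕ}
    (e : (S × Fin m) ⊕ Fin q ≃ Fin a) (C : GenCircuit ι (Fin m))
    (ρ : Bool → DensityMatrix (Bits (Fin m))) (hC : C.prepared = (ρ false).mat) :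
    (prepProtocol e C).apply (eprPairs 0) = (codeState e ρ fun _ _ => false).mat := by
  ext ⟨x, b⟩ ⟨x', b'⟩
  rw [prepProtocol_apply, codeState_apply, ← Finset.mul_sum, sum_mul_ebits, hC, mul_left_comm]
  congr 1
  rw [mul_ite, mul_one, mul_zero]

/-! ### Polynomially bounded and negligible functions -/

namespace PolyBounded

variable {f g : ℕ → ℕ}

theorem of_le (hg : PolyBounded g) (h : ∀ l, f l ≤ g l) : PolyBounded f := by
  obtain ⟨P, hP⟩ := hg
  exact ⟨P, fun l => (h l).trans (hP l)⟩

theorem const (c : ℕ) : PolyBounded fun _ => c :=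
  ⟨Polynomial.C c, fun l => by simp⟩

theorem add (hf : PolyBounded f) (hg : PolyBounded g) : PolyBounded fun l => f l + g l := by
  obtain ⟨P, hP⟩ := hf
  obtain ⟨Q, hQ⟩ := hg
  exact ⟨P + Q, fun l => by rw [Polynomial.eval_add]; exact Nat.add_le_add (hP l) (hQ l)⟩

theorem mul (hf : PolyBounded f) (hg : PolyBounded g) : PolyBounded fun l => f l * g l := by
  obtain ⟨P, hP⟩ := hf
  obtain ⟨Q, hQ⟩ := hg
  exact ⟨P * Q, fun l => by rw [Polynomial.eval_mul]; exact Nat.mul_le_mul (hP l) (hQ l)⟩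

end PolyBounded

theorem eval_map_natCast (P : Polynomial ℕ) (l : ℕ) :
    (P.map (Nat.castRingHom ℝ)).eval (l : ℝ) = (P.eval l : ℕ) := by
  rw [← Nat.coe_castRingHom, Polynomial.eval_map_apply, Nat.coe_castRingHom]

theorem Negligible.natCast_mul {f : ℕ → ℕ} {μ : ℕ → ℝ} (hμ : Negligible μ) (hf : PolyBounded f) :
    Negligible fun l => f l * μ l := by
  obtain ⟨Q, hQ⟩ := hf
  intro P hP
  have hQ0 : ∀ l : ℕ, (0 : ℝ) ≤ ((Q.eval l : ℕ) : ℝ) := fun l => Nat.cast_nonneg _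
  have hpos : ∀ l : ℕ, 0 < (P * (Q.map (Nat.castRingHom ℝ) + 1)).eval (l : ℝ) := fun l => by
    rw [Polynomial.eval_mul, Polynomial.eval_add, eval_map_natCast, Polynomial.eval_one]
    exact mul_pos (hP l) (by have := hQ0 l; linarith)
  obtain ⟨N, hN⟩ := hμ _ hpos
  refine ⟨N, fun l hl => ?_⟩
  have h1 := hN l hl
  rw [Polynomial.eval_mul, Polynomial.eval_add, eval_map_natCast, Polynomial.eval_one] at h1
  have h2 : (f l : ℝ) ≤ ((Q.eval l : ℕ) : ℝ) := Nat.cast_le.mpr (hQ l)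
  have h3 := hP l
  have h4 := hQ0 l
  have h5 : (0 : ℝ) ≤ f l := Nat.cast_nonneg _
  rw [abs_mul, abs_of_nonneg h5]
  rw [lt_div_iff₀ (mul_pos h3 (by linarith))] at h1
  rw [lt_div_iff₀ h3]
  have h6 := abs_nonneg (μ l)
  calc (f l : ℝ) * |μ l| * P.eval (l : ℝ) ≤ (((Q.eval l : ℕ) : ℝ) + 1) * |μ l| * P.eval (l : ℝ) :=
      by
        gcongr
        linarith
    _ = |μ l| * (P.eval (l : ℝ) * (((Q.eval l : ℕ) : ℝ) + 1)) := by ring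
    _ < 1 := h1

/-- If every choice of indices has a negligible bound, then all indices have a common one. -/
theorem exists_negligible_forall {I : ℕ → Type} [∀ l, Finite (I l)] [∀ l, Nonempty (I l)]
    (A : ∀ l, I l → Set ℝ)
    (h : ∀ κ : ∀ l, I l, ∃ μ, Negligible μ ∧ ∀ l, ∀ a ∈ A l (κ l), a ≤ μ l) :
    ∃ μ, Negligible μ ∧ ∀ l i, ∀ a ∈ A l i, a ≤ μ l := by
  have hbdd : ∀ l i, BddAbove (A l i) := by
    intro l i
    -- A choice of indices that passes through `i` at `l` bounds this single set.
    obtain ⟨μ, -, hμ⟩ := h (Function.update (fun _ => Classical.arbitrary _) l i)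
    refine ⟨μ l, fun a ha => hμ l a ?_⟩
    rwa [Function.update_self]
  -- The worst index for each `l` is itself a choice of indices, so its negligible bound dominates
  -- all others.
  choose κ hκ using fun l => Finite.exists_max fun i => sSup (A l i)
  obtain ⟨μ, hμ, hle⟩ := h κ
  -- The absolute value makes the bound nonnegative, which covers an empty `A l (κ l)`, where `sSup`
  -- is `0`.
  refine ⟨fun l => |μ l|, fun P hP => ?_, fun l i a ha => ?_⟩
  · obtain ⟨N, hN⟩ := hμ P hP
    exact ⟨N, fun l hl => by rw [abs_abs]; exact hN l hl⟩
  · calc a ≤ sSup (A l i) := le_csSup (hbdd l i) ha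
      _ ≤ sSup (A l (κ l)) := hκ l i
      _ ≤ |μ l| := Real.sSup_le (fun b hb => (hle l b hb).trans (le_abs_self _)) (abs_nonneg _)

/-! ### Exchanging one state of a product -/

namespace GenCircuit

variable {ι ι' ο : Type}

/-- Renaming of the inputs. -/
def relabel (C : GenCircuit ι ο) (E : ι' ≃ ι) : GenCircuit ι' ο :=
  { C with inp := (Equiv.sumCongr E (Equiv.refl _)).trans C.inp }

theorem kraus_relabel (C : GenCircuit ι ο) (E : ι' ≃ ι) (t : Bits (Fin C.traced)) :
    (C.relabel E).kraus t = (C.kraus t).submatrix id fun z i => z (E.symm i) := by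
  ext u z
  simp only [kraus, relabel, Matrix.submatrix_apply, id]
  congr 1
  funext w
  change Sum.elim z _ ((Equiv.sumCongr E (Equiv.refl _)).symm (C.inp.symm w)) = _
  rcases C.inp.symm w with i | i <;> rfl

theorem run_relabel [Fintype ι] [DecidableEq ι] [Fintype ι'] [DecidableEq ι']
    (C : GenCircuit ι ο) (E : ι' ≃ ι) (ρ : Matrix (Bits ι') (Bits ι') ℂ) :
    (C.relabel E).run ρ =
      C.run (ρ.submatrix (fun (x : Bits ι) i => x (E i)) fun (x : Bits ι) i => x (E i)) := by
  let F : Bits ι ≃ Bits ι' := Equiv.arrowCongr E.symm (Equiv.refl Bool)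
  have h : ∀ K : Matrix (Bits ο) (Bits ι) ℂ, K.submatrix id F.symm * ρ *
      (K.submatrix id F.symm).conjTranspose = K * ρ.submatrix F F * K.conjTranspose := by
    intro K
    have e2 : ρ = (ρ.submatrix F F).submatrix F.symm F.symm := by
      ext x y; simp
    rw [Matrix.conjTranspose_submatrix]
    conv_lhs => rw [e2]
    rw [Matrix.submatrix_mul_equiv, Matrix.submatrix_mul_equiv, Matrix.submatrix_id_id]
  have h' : (C.relabel E).run ρ = ∑ t : Bits (Fin C.traced), (C.relabel E).kraus t * ρ *
    ((C.relabel E).kraus t).conjTranspose := rfl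
  rw [h', run]
  refine Finset.sum_congr rfl fun t _ => ?_
  rw [kraus_relabel]
  exact h (C.kraus t)

/-- The probability that the output qubit of a circuit with an advice register is `1`. -/
def acceptProb [Fintype ι] [DecidableEq ι] {d : ℕ} (C : GenCircuit (ι ⊕ Fin d) (Fin 1))
    (α : DensityMatrix (Bits (Fin d))) (ρ : Matrix (Bits ι) (Bits ι) ℂ) : ℝ :=
  (C.run (joint ρ α.mat) (fun _ => true) (fun _ => true)).re

theorem acceptProb_smul_sum [Fintype ι] [DecidableEq ι] {d : ℕ}
    (C : GenCircuit (ι ⊕ Fin d) (Fin 1)) (α : DensityMatrix (Bits (Fin d))) {Z : Type} [Fintype Z]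
    (r : ℝ) (ρ : Z → Matrix (Bits ι) (Bits ι) ℂ) :
    C.acceptProb α ((r : ℂ) • ∑ z, ρ z) = r * ∑ z, C.acceptProb α (ρ z) := by
  have h : joint ((r : ℂ) • ∑ z, ρ z) α.mat = (r : ℂ) • ∑ z, joint (ρ z) α.mat := by
    ext x y
    simp only [joint, Matrix.of_apply, Matrix.smul_apply, Matrix.sum_apply, smul_eq_mul,
      Finset.sum_mul, mul_assoc]
  have h2 : C.run (joint ((r : ℂ) • ∑ z, ρ z) α.mat) =
      (r : ℂ) • ∑ z, C.run (joint (ρ z) α.mat) := by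
    rw [h]
    simp only [run, Matrix.mul_smul, Matrix.smul_mul, Matrix.mul_sum, Matrix.sum_mul,
      ← Finset.smul_sum]
    rw [Finset.sum_comm]
  rw [acceptProb, h2, Matrix.smul_apply, Matrix.sum_apply, smul_eq_mul, Complex.re_ofReal_mul,
    Complex.re_sum]
  rfl

end GenCircuit

section Hybrid

variable {K T ι : Type} [Fintype K] [DecidableEq K] [Fintype T] [DecidableEq T] [Fintype ι]
  [DecidableEq ι] {m d : ℕ}

/-- The product of the states `ρ (c k)` and the state `τ`. -/
def hybridState (e : (K × Fin m) ⊕ T ≃ ι) (ρ : Bool → DensityMatrix (Bits (Fin m)))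
    (c : K → Bool) (τ : DensityMatrix (Bits T)) : Matrix (Bits ι) (Bits ι) ℂ :=
  Matrix.of fun x y => (∏ k, (ρ (c k)).mat (fun i => x (e (.inl (k, i))))
    (fun i => y (e (.inl (k, i))))) * τ.mat (fun j => x (e (.inr j))) (fun j => y (e (.inr j)))

/-- All qubits except for those of one of the states. -/
abbrev OtherQubits (T : Type) (m d : ℕ) (k : K) : Type := ({k' // k' ≠ k} × Fin m) ⊕ (T ⊕ Fin d)

/-- The inclusion of one of the states and of the other qubits. -/
def splitOffMap (e : (K × Fin m) ⊕ T ≃ ι) (d : ℕ) (k : K) :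
    Fin m ⊕ Fin (Fintype.card (OtherQubits T m d k)) → ι ⊕ Fin d
  | .inl i => .inl (e (.inl (k, i)))
  | .inr j => match (Fintype.equivFin (OtherQubits T m d k)).symm j with
    | .inl (k', i) => .inl (e (.inl (k'.1, i)))
    | .inr (.inl t) => .inl (e (.inr t))
    | .inr (.inr a) => .inr a

theorem splitOffMap_bijective (e : (K × Fin m) ⊕ T ≃ ι) (d : ℕ) (k : K) :
    Function.Bijective (splitOffMap e d k) := by
  constructor
  · rintro (i | j) (i' | j') h
    · simpa [splitOffMap] using h
    · obtain ⟨r, rfl⟩ := (Fintype.equivFin (OtherQubits T m d k)).surjective j'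
      rcases r with ⟨⟨k', hk⟩, i'⟩ | t | a <;> simp [splitOffMap] at h
      exact absurd h.1.symm hk
    · obtain ⟨r, rfl⟩ := (Fintype.equivFin (OtherQubits T m d k)).surjective j
      rcases r with ⟨⟨k', hk⟩, i'⟩ | t | a <;> simp [splitOffMap] at h
      exact absurd h.1 hk
    · obtain ⟨r, rfl⟩ := (Fintype.equivFin (OtherQubits T m d k)).surjective j
      obtain ⟨r', rfl⟩ := (Fintype.equivFin (OtherQubits T m d k)).surjective j'
      rcases r with ⟨⟨k₁, hk₁⟩, i₁⟩ | t | a <;> rcases r' with ⟨⟨k₂, hk₂⟩, i₂⟩ | t₂ | a₂ <;>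
        simp [splitOffMap] at h ⊢ <;> exact h
  · rintro (x | a)
    · obtain ⟨r, rfl⟩ := e.surjective x
      rcases r with ⟨k', i⟩ | t
      · by_cases hk : k' = k
        · subst hk
          exact ⟨.inl i, rfl⟩
        · exact ⟨.inr (Fintype.equivFin _ (.inl (⟨k', hk⟩, i))), by simp [splitOffMap]⟩
      · exact ⟨.inr (Fintype.equivFin _ (.inr (.inl t))), by simp [splitOffMap]⟩
    · exact ⟨.inr (Fintype.equivFin _ (.inr (.inr a))), by simp [splitOffMap]⟩

/-- `splitOffMap` as an equivalence. -/
def splitOff (e : (K × Fin m) ⊕ T ≃ ι) (d : ℕ) (k : K) :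
    Fin m ⊕ Fin (Fintype.card (OtherQubits T m d k)) ≃ ι ⊕ Fin d :=
  Equiv.ofBijective _ (splitOffMap_bijective e d k)

/-- The basis of the other qubits. -/
def otherBits (T : Type) [Fintype T] (m d : ℕ) (k : K) :
    ({k' // k' ≠ k} → Bits (Fin m)) × (Bits T × Bits (Fin d)) ≃
      Bits (Fin (Fintype.card (OtherQubits T m d k))) where
  toFun v j := Sum.elim (fun r => v.1 r.1 r.2) (Sum.elim v.2.1 v.2.2)
    ((Fintype.equivFin (OtherQubits T m d k)).symm j)
  invFun x := (fun k' i => x (Fintype.equivFin (OtherQubits T m d k) (.inl (k', i))),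
    fun t => x (Fintype.equivFin (OtherQubits T m d k) (.inr (.inl t))),
    fun a => x (Fintype.equivFin (OtherQubits T m d k) (.inr (.inr a))))
  left_inv v := by simp
  right_inv x := by
    funext j
    obtain ⟨r, rfl⟩ := (Fintype.equivFin (OtherQubits T m d k)).surjective j
    rcases r with r | r | r <;> simp

/-- The state of all other qubits. -/
def otherState (ρ : Bool → DensityMatrix (Bits (Fin m))) (c : K → Bool)
    (τ : DensityMatrix (Bits T)) (α : DensityMatrix (Bits (Fin d))) (k : K) :
    DensityMatrix (Bits (Fin (Fintype.card (OtherQubits T m d k)))) :=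
  ((DensityMatrix.pi fun k' : {k' // k' ≠ k} => ρ (c k'.1)).kron (τ.kron α)).reindex
    (otherBits T m d k)

/-- This is the reduction: everything except the `k`-th state, including the original advice, is
absorbed into one advice state that does not depend on `b`. Advice may be any state, so the phases
and the other blocks need not be efficiently preparable. -/
theorem joint_otherState (e : (K × Fin m) ⊕ T ≃ ι) (ρ : Bool → DensityMatrix (Bits (Fin m)))
    (c : K → Bool) (τ : DensityMatrix (Bits T)) (α : DensityMatrix (Bits (Fin d))) (k : K)
    (b : Bool) :
    (joint (ρ b).mat (otherState ρ c τ α k).mat).submatrix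
      (fun (x : Bits (ι ⊕ Fin d)) i => x (splitOff e d k i))
      (fun (x : Bits (ι ⊕ Fin d)) i => x (splitOff e d k i)) =
      joint (hybridState e ρ (Function.update c k b) τ) α.mat := by
  ext x y
  have h1 : ∀ x : Bits (ι ⊕ Fin d), (otherBits T m d k).symm
      (fun j => x (splitOff e d k (.inr j))) =
      ((fun k' i => x (.inl (e (.inl (k'.1, i))))), (fun t => x (.inl (e (.inr t)))),
        fun a => x (.inr a)) := by
    intro x
    simp [otherBits, splitOff, splitOffMap]
  simp only [Matrix.submatrix_apply, joint, Matrix.of_apply, otherState, DensityMatrix.reindex,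
    hybridState, h1, Fintype.prod_eq_mul_prod_subtype_ne _ k, Function.update_self]
  have h2 : ∀ k' : {k' // k' ≠ k}, Function.update c k b k'.1 = c k'.1 := fun k' =>
    Function.update_of_ne k'.2 _ _
  simp only [h2]
  change (ρ b).mat _ _ * ((∏ k' : {k' // k' ≠ k}, (ρ (c k'.1)).mat _ _) *
    (τ.mat _ _ * α.mat _ _)) = _
  rw [mul_assoc, mul_assoc]
  rfl

/-- The distinguisher that uses the given state in place of one of the states of the product. -/
def exchangeCircuit (e : (K × Fin m) ⊕ T ≃ ι) (C : GenCircuit (ι ⊕ Fin d) (Fin 1)) :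
    Option K → Σ d', GenCircuit (Fin m ⊕ Fin d') (Fin 1)
  | some k => ⟨_, C.relabel (splitOff e d k)⟩
  -- This circuit always outputs `0`. It only keeps the set of indices inhabited when there is no
  -- state to exchange, for example when `t` or `p` vanishes.
  | none => ⟨0, { wires := m + 1
                  zeros := 1
                  traced := m
                  inp := (Equiv.sumCongr (Equiv.sumEmpty _ _) (Equiv.refl _)).trans finSumFinEquiv
                  out := (Equiv.sumComm _ _).trans finSumFinEquiv
                  gates := [] }⟩

theorem size_exchangeCircuit_le (e : (K × Fin m) ⊕ T ≃ ι) (C : GenCircuit (ι ⊕ Fin d) (Fin 1))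
    (k : Option K) : (exchangeCircuit e C k).2.size ≤ C.size + (m + 1) := by
  cases k with
  | some k => exact Nat.le_add_right _ _
  | none => simp [exchangeCircuit, GenCircuit.size]

theorem acceptProb_hybridState_update (e : (K × Fin m) ⊕ T ≃ ι)
    (C : GenCircuit (ι ⊕ Fin d) (Fin 1)) (ρ : Bool → DensityMatrix (Bits (Fin m)))
    (c : K → Bool) (τ : DensityMatrix (Bits T)) (α : DensityMatrix (Bits (Fin d))) (k : K)
    (b : Bool) :
    C.acceptProb α (hybridState e ρ (Function.update c k b) τ) =
      (C.relabel (splitOff e d k)).acceptProb (otherState ρ c τ α k) (ρ b).mat := by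
  simp only [GenCircuit.acceptProb]
  rw [GenCircuit.run_relabel, joint_otherState]

end Hybrid

/-- The hybrid argument: coordinates are switched from `false` to their value in `c` one at a time,
and each switch costs at most `μ`. -/
theorem abs_sub_le_of_update {K : Type} [Fintype K] [DecidableEq K] (F : (K → Bool) → ℝ) (μ : ℝ)
    (h : ∀ k c, |F (Function.update c k false) - F (Function.update c k true)| ≤ μ)
    (c : K → Bool) : |F (fun _ => false) - F c| ≤ Fintype.card K * μ := by
  have key : ∀ s : Finset K, |F (fun _ => false) - F fun k => if k ∈ s then c k else false| ≤
      s.card * μ := by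
    intro s
    induction s using Finset.induction_on with
    | empty => simp
    | insert k s hk ih =>
      set c' : K → Bool := fun k => if k ∈ s then c k else false with hc'
      have h1 : (fun k' => if k' ∈ insert k s then c k' else false) = Function.update c' k (c k)
          := by
        funext k'
        by_cases hkk : k' = k
        · subst hkk; simp
        · simp [hkk, hc']
      have h2 : c' = Function.update c' k false := by
        rw [eq_comm, Function.update_eq_self_iff]
        simp [hc', hk]
      have h3 : |F c' - F (Function.update c' k (c k))| ≤ μ := by
        have h4 := h k c'
        cases c k with
        | true => rwa [← h2] at h4
        | false =>
          rw [← h2, sub_self, abs_zero]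
          exact (abs_nonneg _).trans h4
      rw [h1, Finset.card_insert_of_notMem hk]
      push_cast
      calc |F (fun _ => false) - F (Function.update c' k (c k))|
          ≤ |F (fun _ => false) - F c'| + |F c' - F (Function.update c' k (c k))| :=
            abs_sub_le _ _ _
        _ ≤ s.card * μ + μ := add_le_add ih h3
        _ = (s.card + 1) * μ := by ring
  simpa using key Finset.univ

/-- The code `c`, the state `τ` and the advice `α` enter the reduction only through its advice, over
which indistinguishability is uniform; the exchanged position is handled by
`exists_negligible_forall`. Hence one `μ` serves all of them. -/
theorem exists_negligible_hybridState {m : ℕ → ℕ} {K T ι : ℕ → Type} [∀ l, Fintype (K l)]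
    [∀ l, DecidableEq (K l)] [∀ l, Fintype (T l)] [∀ l, DecidableEq (T l)] [∀ l, Fintype (ι l)]
    [∀ l, DecidableEq (ι l)] (e : ∀ l, (K l × Fin (m l)) ⊕ T l ≃ ι l) (hm : PolyBounded m)
    (ρ : ∀ l, Bool → DensityMatrix (Bits (Fin (m l))))
    (hρ : CompIndistinguishable (fun l => (ρ l false).mat) fun l => (ρ l true).mat)
    (D : Distinguisher ι) : ∃ μ, Negligible μ ∧ ∀ l α c τ,
      |D.prob l α (hybridState (e l) (ρ l) (fun _ => false) τ) -
        D.prob l α (hybridState (e l) (ρ l) c τ)| ≤ Fintype.card (K l) * μ l := by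
  obtain ⟨μ, hμ, h⟩ := exists_negligible_forall (I := fun l => Option (K l))
    (fun l k => Set.range fun α : DensityMatrix (Bits (Fin (exchangeCircuit (e l) (D.circuit l)
        k).1)) =>
      |(exchangeCircuit (e l) (D.circuit l) k).2.acceptProb α (ρ l false).mat -
        (exchangeCircuit (e l) (D.circuit l) k).2.acceptProb α (ρ l true).mat|) (by
    intro κ
    obtain ⟨μ, hμ, h⟩ := hρ
      { advice := fun l => (exchangeCircuit (e l) (D.circuit l) (κ l)).1
        circuit := fun l => (exchangeCircuit (e l) (D.circuit l) (κ l)).2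
        polySize := (D.polySize.add (hm.add (PolyBounded.const 1))).of_le fun l =>
          size_exchangeCircuit_le (e l) (D.circuit l) (κ l) }
    refine ⟨μ, hμ, ?_⟩
    rintro l _ ⟨α, rfl⟩
    exact h l α)
  refine ⟨μ, hμ, fun l α c τ => ?_⟩
  refine abs_sub_le_of_update (fun c => D.prob l α (hybridState (e l) (ρ l) c τ)) (μ l)
    (fun k c => ?_) c
  refine h l (some k) _ ⟨otherState (ρ l) c τ α k, ?_⟩
  exact congrArg abs (congrArg₂ (· - ·)
    (acceptProb_hybridState_update (e l) (D.circuit l) (ρ l) c τ α k false).symm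
    (acceptProb_hybridState_update (e l) (D.circuit l) (ρ l) c τ α k true).symm)

/-! ### Copies of code states -/

section Copies

variable {S : Type} [Fintype S] [DecidableEq S] {q m a : ℕ}

/-- The qubits of several copies of a code state. -/
def copiesMap (e : (S × Fin m) ⊕ Fin q ≃ Fin a) (p : ℕ) :
    ((Fin p × S) × Fin m) ⊕ (Fin p × (Fin q ⊕ Fin q)) → Fin p × (Fin a ⊕ Fin q)
  | .inl ((i, s), u) => (i, .inl (e (.inl (s, u))))
  | .inr (i, .inl j) => (i, .inl (e (.inr j)))
  | .inr (i, .inr j) => (i, .inr j)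

theorem copiesMap_bijective (e : (S × Fin m) ⊕ Fin q ≃ Fin a) (p : ℕ) :
    Function.Bijective (copiesMap e p) := by
  constructor
  · rintro (⟨⟨i, s⟩, u⟩ | ⟨i, j | j⟩) (⟨⟨i', s'⟩, u'⟩ | ⟨i', j' | j'⟩) h <;>
      simp [copiesMap] at h ⊢ <;> simp [h]
  · rintro ⟨i, x | j⟩
    · obtain ⟨r, rfl⟩ := e.surjective x
      rcases r with ⟨s, u⟩ | j
      · exact ⟨.inl ((i, s), u), rfl⟩
      · exact ⟨.inr (i, .inl j), rfl⟩
    · exact ⟨.inr (i, .inr j), rfl⟩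

/-- `copiesMap` as an equivalence. -/
def copiesEquiv (e : (S × Fin m) ⊕ Fin q ≃ Fin a) (p : ℕ) :
    ((Fin p × S) × Fin m) ⊕ (Fin p × (Fin q ⊕ Fin q)) ≃ Fin p × (Fin a ⊕ Fin q) :=
  Equiv.ofBijective _ (copiesMap_bijective e p)

/-- Several families of Bell states. -/
def copiesEbits (p : ℕ) (z : Fin p → Bits (Fin q)) :
    DensityMatrix (Bits (Fin p × (Fin q ⊕ Fin q))) :=
  (DensityMatrix.pi fun i => ebitsState (z i)).reindex
    { toFun := fun v k => Sum.elim (v k.1).1 (v k.1).2 k.2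
      invFun := fun x i => (fun j => x (i, .inl j), fun j => x (i, .inr j))
      left_inv := fun v => by simp
      right_inv := fun x => by
        funext ⟨i, j⟩
        rcases j with j | j <;> rfl }

/-- Expanding the `p`-fold product of mixtures gives a mixture over `p`-tuples of phases, each term
being a product to which the hybrid argument applies. The Bell part is the same for all codes. -/
theorem copies_codeState (e : (S × Fin m) ⊕ Fin q ≃ Fin a) (p : ℕ)
    (ρ : Bool → DensityMatrix (Bits (Fin m))) (c : Bits (Fin q) → S → Bool) :
    copies p (codeState e ρ c).mat = ((((2 ^ q)⁻¹ ^ p : ℝ)) : ℂ) •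
      ∑ z : Fin p → Bits (Fin q),
        hybridState (copiesEquiv e p) ρ (fun k => c (z k.1) k.2) (copiesEbits p z) := by
  ext x y
  simp only [copies, Matrix.of_apply, codeState_apply, Matrix.smul_apply, Matrix.sum_apply,
    smul_eq_mul]
  rw [Finset.prod_mul_distrib, Finset.prod_const, Finset.card_univ, Fintype.card_fin]
  congr 1
  · push_cast; rfl
  rw [← sum_prod_pi fun i z =>
      (∏ s, (ρ (c z s)).mat (fun u => x (i, .inl (e (.inl (s, u)))))
        fun u => y (i, .inl (e (.inl (s, u))))) *
        (ebits z (fun j => x (i, .inl (e (.inr j))), fun j => x (i, .inr j)) *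
          ebits z (fun j => y (i, .inl (e (.inr j))), fun j => y (i, .inr j)))]
  refine Finset.sum_congr rfl fun z _ => ?_
  rw [Finset.prod_mul_distrib, hybridState, Matrix.of_apply, Fintype.prod_prod_type]
  congr 1
  simp only [copiesEbits, DensityMatrix.reindex, DensityMatrix.pi, Matrix.submatrix_apply,
    piMat_apply, ebitsState, DensityMatrix.pure]
  refine Finset.prod_congr rfl fun i _ => ?_
  rw [Matrix.vecMulVec_apply, Pi.star_apply, star_ebits]
  rfl

end Copies

theorem compIndistinguishable_copies {m q t a p : ℕ → ℕ}
    (e : ∀ l, ((Fin (q l) × Fin (t l)) × Fin (m l)) ⊕ Fin (q l) ≃ Fin (a l))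
    (hm : PolyBounded m) (hq : PolyBounded q) (ht : PolyBounded t) (hp : PolyBounded p)
    (ρ : ∀ l, Bool → DensityMatrix (Bits (Fin (m l))))
    (hρ : CompIndistinguishable (fun l => (ρ l false).mat) fun l => (ρ l true).mat)
    (c : ∀ l, Bits (Fin (q l)) → Fin (q l) × Fin (t l) → Bool) :
    CompIndistinguishable (fun l => copies (p l) (codeState (e l) (ρ l) fun _ _ => false).mat)
      (fun l => copies (p l) (codeState (e l) (ρ l) (c l)).mat) := by
  intro D
  obtain ⟨μ, hμ, h⟩ := exists_negligible_hybridState (fun l => copiesEquiv (e l) (p l)) hm ρ hρ D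
  refine ⟨_, hμ.natCast_mul (f := fun l => Fintype.card (Fin (p l) × (Fin (q l) × Fin (t l)))) ?_,
    fun l α => ?_⟩
  · simp only [Fintype.card_prod, Fintype.card_fin]
    exact hp.mul (hq.mul ht)
  have hlin : ∀ c, D.prob l α (copies (p l) (codeState (e l) (ρ l) c).mat) =
      ((2 ^ q l)⁻¹ ^ p l : ℝ) * ∑ z : Fin (p l) → Bits (Fin (q l)), D.prob l α
        (hybridState (copiesEquiv (e l) (p l)) (ρ l) (fun k => c (z k.1) k.2)
          (copiesEbits (p l) z)) := by
    intro c
    rw [copies_codeState]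
    exact GenCircuit.acceptProb_smul_sum (D.circuit l) α _ _
  -- The two mixtures are compared term by term at equal phases, and the weights sum to one.
  rw [hlin, hlin, ← mul_sub, ← Finset.sum_sub_distrib, abs_mul, abs_of_nonneg (by positivity)]
  calc _ ≤ ((2 ^ q l)⁻¹ ^ p l : ℝ) * ∑ z : Fin (p l) → Bits (Fin (q l)),
        (Fintype.card (Fin (p l) × (Fin (q l) × Fin (t l))) : ℝ) * μ l := by
        refine mul_le_mul_of_nonneg_left ?_ (by positivity)
        exact (Finset.abs_sum_le_sum_abs _ _).trans (Finset.sum_le_sum fun z _ => h l α _ _)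
    _ = _ := by
        rw [Finset.sum_const, Finset.card_univ, nsmul_eq_mul, ← mul_assoc]
        have : ((2 ^ q l)⁻¹ ^ p l : ℝ) * (Fintype.card (Fin (p l) → Bits (Fin (q l))) : ℝ) = 1 := by
          simp only [Fintype.card_fun, Fintype.card_fin, Fintype.card_bool, Nat.cast_pow,
            Nat.cast_ofNat]
          rw [← mul_pow, inv_mul_cancel₀ (by positivity), one_pow]
        rw [this, one_mul]

/-! ### The parameters and the main result -/

theorem exists_natPolynomial_ge (P : Polynomial ℝ) :
    ∃ Q : Polynomial ℕ, ∀ l : ℕ, P.eval (l : ℝ) ≤ (Q.eval l : ℕ) := by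
  induction P using Polynomial.induction_on' with
  | add P₁ P₂ h₁ h₂ =>
    obtain ⟨Q₁, h₁⟩ := h₁
    obtain ⟨Q₂, h₂⟩ := h₂
    refine ⟨Q₁ + Q₂, fun l => ?_⟩
    rw [Polynomial.eval_add, Polynomial.eval_add, Nat.cast_add]
    exact add_le_add (h₁ l) (h₂ l)
  | monomial k r =>
    refine ⟨Polynomial.monomial k ⌈r⌉₊, fun l => ?_⟩
    rw [Polynomial.eval_monomial, Polynomial.eval_monomial, Nat.cast_mul, Nat.cast_pow]
    exact mul_le_mul_of_nonneg_right (Nat.le_ceil r) (by positivity)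

/-- Eventually `q l ≤ e^l`, so half of the exponent absorbs `q` and `e^{-l} ≤ 2^{-l}` remains. Thus
`t` can be fixed before `q` is known. -/
theorem isBigO_min_polyBounded_mul_exp {q : ℕ → ℕ} (hq : PolyBounded q) :
    (fun l : ℕ => min 1 (q l * (1 / 2 * Real.exp (-(2 * l))))) =O[Filter.atTop]
      fun l : ℕ => ((2 : ℝ) ^ l)⁻¹ := by
  obtain ⟨Q, hQ⟩ := hq
  have h1 := (Polynomial.tendsto_div_exp_atTop (Q.map (Nat.castRingHom ℝ))).comp
    tendsto_natCast_atTop_atTop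
  have h2 : ∀ᶠ l : ℕ in Filter.atTop, ((Q.eval l : ℕ) : ℝ) / Real.exp l < 1 := by
    filter_upwards [h1.eventually_lt_const one_pos] with l hl
    rwa [Function.comp_apply, eval_map_natCast] at hl
  refine Asymptotics.IsBigO.of_bound 1 ?_
  filter_upwards [h2] with l hl
  have hx : 0 ≤ (q l : ℝ) * (1 / 2 * Real.exp (-(2 * l))) := by positivity
  rw [Real.norm_of_nonneg (le_min zero_le_one hx), Real.norm_of_nonneg (by positivity), one_mul]
  refine (min_le_right _ _).trans ?_
  have hql : (q l : ℝ) ≤ Real.exp l := by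
    rw [div_lt_one (Real.exp_pos _)] at hl
    exact (Nat.cast_le.mpr (hQ l)).trans hl.le
  have h3 : (2 : ℝ) ^ l ≤ Real.exp l := by
    rw [← mul_one (l : ℝ), Real.exp_nat_mul]
    exact pow_le_pow_left₀ (by norm_num) (by linarith [Real.add_one_le_exp (1 : ℝ)]) l
  calc (q l : ℝ) * (1 / 2 * Real.exp (-(2 * l))) ≤ Real.exp l * (1 * Real.exp (-(2 * l))) := by
        gcongr
        norm_num
    _ = (Real.exp l)⁻¹ := by
        rw [one_mul, ← Real.exp_add, ← Real.exp_neg]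
        congr 1
        ring
    _ ≤ ((2 : ℝ) ^ l)⁻¹ := inv_anti₀ (by positivity) h3

theorem exp_neg_sq_pow_le {δ Q : ℝ} (l t : ℕ) (ht : (t : ℝ) = 4 * l * Q ^ 2) (h : 1 ≤ Q * δ) :
    Real.exp (-δ ^ 2 / 2) ^ t ≤ Real.exp (-(2 * l)) := by
  rw [← Real.exp_nat_mul, ht]
  apply Real.exp_le_exp.mpr
  have h2 : 1 ≤ (Q * δ) ^ 2 := one_le_pow₀ h
  have h3 : (0 : ℝ) ≤ l := Nat.cast_nonneg l
  nlinarith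

/-- Outputs are wires, so the size of the generator bounds the number of qubits it prepares. -/
theorem PolyBounded.of_genCircuit {ι : ℕ → Type} {m : ℕ → ℕ}
    (A : ∀ l, GenCircuit (ι l) (Fin (m l))) (hA : PolyBounded fun l => (A l).size) :
    PolyBounded m := by
  refine hA.of_le fun l => ?_
  have h := Fintype.card_congr (A l).out
  simp only [Fintype.card_sum, Fintype.card_fin] at h
  rw [GenCircuit.size]
  lia

/-- The qubits of the first party. -/
def blockQubits (q t m : ℕ) : ((Fin q × Fin t) × Fin m) ⊕ Fin q ≃ Fin (q * (t * m + 1)) :=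
  Fintype.equivFinOfCardEq (by
    simp only [Fintype.card_sum, Fintype.card_prod, Fintype.card_fin]
    ring)

end PseudoEnt
end

open PseudoEnt in
theorem corollary4p2 (m : ℕ → ℕ)
    (ρ₀ ρ₁ : ∀ l, PseudoEnt.DensityMatrix (PseudoEnt.Bits (Fin (m l))))
    (hEFI : PseudoEnt.IsEFIPair ρ₀ ρ₁) :
    ∃ t n : ℕ → ℕ, PseudoEnt.PolyBounded t ∧ PseudoEnt.PolyBounded n ∧
      (∀ l, n l = t l * m l + 1) ∧
      ∀ q : ℕ → ℕ, PseudoEnt.PolyBounded q →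
        ∃ (ε : ℕ → ℝ) (ψ φ : ∀ l, PseudoEnt.BipartiteState (q l * n l) (q l)),
          (∀ l, 0 ≤ ε l ∧ ε l ≤ 1) ∧
          ε =O[Filter.atTop] (fun l : ℕ => ((2 : ℝ) ^ l)⁻¹) ∧
          PseudoEnt.CompEntanglementCostLE ε ψ (fun _ => 0) ∧
          (∀ E : PseudoEnt.EntanglementMeasure,
            (∀ (a b : ℕ) (δ : ℝ) (ρ : PseudoEnt.BipartiteState a b), 0 ≤ δ → δ ≤ 1 →
              E a b δ ρ ≤ PseudoEnt.entanglementCost δ ρ) →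
            ∀ l, E _ _ (ε l) (ψ l) = 0) ∧
          (∀ l, (q l : ℝ≥0∞) ≤ PseudoEnt.distillableEntanglement (ε l) (φ l)) ∧
          (∀ E : PseudoEnt.EntanglementMeasure,
            (∀ (a b : ℕ) (δ : ℝ) (ρ : PseudoEnt.BipartiteState a b), 0 ≤ δ → δ ≤ 1 →
              PseudoEnt.distillableEntanglement δ ρ ≤ E a b δ ρ) →
            ∀ l, (q l : ℝ≥0∞) ≤ E _ _ (ε l) (φ l)) ∧
          ∀ p : ℕ → ℕ, PseudoEnt.PolyBounded p →
            PseudoEnt.CompIndistinguishable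
              (fun l => PseudoEnt.copies (p l) (ψ l).mat)
              (fun l => PseudoEnt.copies (p l) (φ l).mat) := by
  obtain ⟨⟨A, ⟨hA, -⟩, hAρ⟩, ⟨P, hP, hfar⟩, hind⟩ := hEFI
  obtain ⟨Q, hQ⟩ := exists_natPolynomial_ge P
  have hm : PolyBounded m := .of_genCircuit A hA
  -- With `Q δ ≥ 1` for the trace distance `δ`, this makes `t δ² / 2` at least `2 l`.
  let t : ℕ → ℕ := fun l => 4 * l * Q.eval l ^ 2
  have ht : PolyBounded t := ⟨4 * Polynomial.X * Q ^ 2, fun l => by simp [t]⟩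
  let ρ : ∀ l, Bool → DensityMatrix (Bits (Fin (m l))) := fun l b => if b then ρ₁ l else ρ₀ l
  refine ⟨t, fun l => t l * m l + 1, ht, (ht.mul hm).add (.const 1), fun _ => rfl,
    fun q hq => ?_⟩
  let e := fun l => blockQubits (q l) (t l) (m l)
  -- The error of the distillation, capped so that it stays in `[0,1]` for small `l`; where the cap
  -- is active, the fidelity bound is trivial.
  let ε : ℕ → ℝ := fun l => min 1 (q l * (1 / 2 * Real.exp (-(2 * l))))
  have hε : ∀ l, 0 ≤ ε l ∧ ε l ≤ 1 := fun l =>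
    ⟨le_min zero_le_one (by positivity), min_le_left _ _⟩
  let ψ : ∀ l, BipartiteState (q l * (t l * m l + 1)) (q l) := fun l =>
    codeState (e l) (ρ l) fun _ _ => false
  let φ : ∀ l, BipartiteState (q l * (t l * m l + 1)) (q l) := fun l =>
    codeState (e l) (ρ l) fun z s => z s.1
  have hprep : ∀ l, (prepProtocol (e l) (A l)).apply (eprPairs 0) = (ψ l).mat := fun l =>
    prepProtocol_apply_eq (e l) (A l) (ρ l)
      (by rw [← GenCircuit.run_basisState_false, (hAρ l).1]; rfl)
  have hcost : ∀ l, 1 - ε l ≤ fidelity ((prepProtocol (e l) (A l)).apply (eprPairs 0)) (ψ l).mat :=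
    fun l => by
      rw [hprep, fidelity_self]
      linarith [(hε l).1]
  have hdist : ∀ l, (q l : ℝ≥0∞) ≤ distillableEntanglement (ε l) (φ l) := by
    intro l
    obtain ⟨Γ, hΓ⟩ := exists_distillation (e l) (ρ l)
    have hδ : 1 ≤ ((Q.eval l : ℕ) : ℝ) * traceDistance (ρ l false).mat (ρ l true).mat := by
      have h1 := hfar l
      rw [div_le_iff₀ (hP l)] at h1
      have h2 : 0 ≤ traceDistance (ρ₀ l).mat (ρ₁ l).mat :=
        (one_div_nonneg.mpr (hP l).le).trans (hfar l)
      calc (1 : ℝ) ≤ traceDistance (ρ₀ l).mat (ρ₁ l).mat * P.eval (l : ℝ) := h1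
        _ ≤ traceDistance (ρ₀ l).mat (ρ₁ l).mat * (Q.eval l : ℕ) :=
            mul_le_mul_of_nonneg_left (hQ l) h2
        _ = _ := mul_comm _ _
    have hexp := exp_neg_sq_pow_le l (t l) (by simp [t]) hδ
    have hΓ' : 1 - ε l ≤ fidelity (Γ.apply (φ l).mat) (eprPairs (q l)) := by
      rcases min_choice (1 : ℝ) (q l * (1 / 2 * Real.exp (-(2 * l)))) with h | h
      · rw [show ε l = 1 from h, sub_self]
        exact sq_nonneg _
      · refine le_trans ?_ hΓ
        rw [show ε l = _ from h]
        gcongr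
    exact le_iSup₂ (f := fun (k : ℕ) (_ : ∃ Γ : LOCC k k _ _, 1 - ε l ≤
      fidelity (Γ.apply (φ l).mat) (eprPairs k)) => (k : ℝ≥0∞)) (q l) ⟨Γ, hΓ'⟩
  refine ⟨ε, ψ, φ, hε, isBigO_min_polyBounded_mul_exp hq, ⟨fun l => prepProtocol (e l) (A l), ?_,
    hcost⟩, fun E hE l => ?_, hdist, fun E hE l => (hdist l).trans (hE _ _ _ _ (hε l).1 (hε l).2),
    fun p hp => compIndistinguishable_copies e hm hq ht hp ρ hind _⟩
  · simp only [size_prepProtocol, Fintype.card_prod, Fintype.card_fin]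
    exact ((((hq.mul ht).mul hA).add ((hq.mul ht).mul hm)).add ((PolyBounded.const 7).mul hq)).add
      (.const 2)
  · refine le_antisymm ((hE _ _ _ _ (hε l).1 (hε l).2).trans ?_) zero_le
    refine (iInf₂_le (f := fun (k : ℕ) (_ : ∃ Γ : LOCC _ _ k k, 1 - ε l ≤
      fidelity (Γ.apply (eprPairs k)) (ψ l).mat) => (k : ℝ≥0∞)) 0 ⟨_, hcost l⟩).trans ?_
    simp
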